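/- Let $2\le n<N$ and $p_0,p_1\in(0,1)$ with $p_0\ne p_1$. Let $\mathcal V$ be a set of subsets of $\{1,\dots,N\}$ of cardinality $n$, and let $V^*\in\mathcal V$. One observes independent undirected random graphs $G^{(1)},G^{(2)},\dots$ on $\{1,\dots,N\}$ with independent edges. Under $\mathbb P_\infty$ every edge has probability $p_0$ at all times; under $\mathbb P_\tau$ ($\tau\ge1$) the edges with both endpoints in $V^*$ have probability $p_1$ at times $t\ge\tau$, and all other edges, and all edges at times $t<\tau$, have probability $p_0$. Let $\mathbb E_\infty,\mathbb E_\tau$ be the expectations. For a stopping time $T$ of the observations put $$\bar{\mathbb E}_0(T)=\sup_{\tau\ge1}\operatorname{ess\,sup}\ \mathbb E_\tau\big[(T-\tau)^+\mid G^{(1)},\dots,G^{(\tau-1)}\big].$$ For $V\in\mathcal V$ and $1\le k\le t$ let $$R_{t,k,V}=\sum_{i,j\in V,\ i<j}\ \sum_{s=k}^{t}\Big[G^{(s)}_{ij}\log\frac{p_1}{p_0}+(1-G^{(s)}_{ij})\log\frac{1-p_1}{1-p_0}\Big].$$ For $\alpha\in(0,1)$ let $m_\alpha,m'_\alpha\ge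 0$ be integers, let $b=b_\alpha$ be real, and let $$T_G=\inf\Big\{t\ge1:\ \max_{k\ge1,\ t-m_\alpha\le k\le t-m'_\alpha}\ \max_{V\in\mathcal V}R_{t,k,V}>b_\alpha\Big\}.$$ Put $I=\binom n2\Big(p_1\log\frac{p_1}{p_0}+(1-p_1)\log\frac{1-p_1}{1-p_0}\Big)$. Assume that $$\liminf_{\alpha\to0}\frac{m_\alpha}{|\log\alpha|}>I^{-1},\qquad \log m_\alpha=o(\log\alpha),\qquad m'_\alpha=o(|\log\alpha|)\qquad(\alpha\to0),$$ and that $2m_\alpha e^{-b_\alpha}\binom Nn=\alpha$ for all $\alpha\in(0,1)$. Then: 1. $\mathbb E_\infty[T_G]\ge\big(\tfrac12-\alpha\big)\big(\tfrac{m_\alpha}{2\alpha}-1\big)$ for all $\alpha\in(0,1)$. 2. As $\alpha\to0$, $b_\alpha\sim|\log\alpha|\to\infty$ and $\bar{\mathbb E}_0(T_G)\le(I^{-1}+o(1))\,b_\alpha$. 3. $T_G$ is first-order asymptotically optimal: $T_G$ is a stopping time and, with $\gamma_\alpha=\mathbb E_\infty[T_G]$, as $\alpha\to0$ one has $\gamma_\alpha\to\infty$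 (with $\gamma_\alpha$ and $\bar{\mathbb E}_0(T_G)$ finite for all small $\alpha$), and both $\bar{\mathbb E}_0(T_G)$ and $\inf\{\bar{\mathbb E}_0(T):T\text{ a stopping time with }\mathbb E_\infty[T]\ge\gamma_\alpha\}$ are equal to $(1+o(1))\,I^{-1}\log\gamma_\alpha$. -/

import Mathlib

open Filter Topology MeasureTheory ProbabilityTheory Asymptotics
open scoped ENNReal unitInterval

noncomputable section

namespace GraphScan

/-- The unordered pairs of distinct nodes of a network with nodes `Fin N`,
each written as an ordered pair `(i, j)` with `i < j`. -/
abbrev NodePair (N : ℕ) : Type := {e : Fin N × Fin N // e.1 < e.2}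

/-- An undirected graph on `N` nodes, given by the entries `G i j`, `i < j`, of its adjacency
matrix. -/
abbrev Graph (N : ℕ) : Type := NodePair N → Bool

/-- A sequence of observed graphs `G⁽¹⁾, G⁽²⁾, …`; the coordinate with index `i : ℕ` is
`G⁽ⁱ⁺¹⁾`. -/
abbrev GraphSeq (N : ℕ) : Type := ℕ → Graph N

/-- The graph `G⁽ᵗ⁾` observed at time `t ≥ 1`. -/
def obs {N : ℕ} (ω : GraphSeq N) (t : ℕ) : Graph N := ω (t - 1)

/-- The pair `e` lies inside the node set `V`. -/
abbrev Inside {N : ℕ} (V : Finset (Fin N)) (e : NodePair N) : Prop := e.1.1 ∈ V ∧ e.1.2 ∈ V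

/-- The law of a random graph whose edges are present independently, the edge at the pair `e` with
probability `q e`. -/
def graphLaw {N : ℕ} (q : NodePair N → I) : Measure (Graph N) :=
  Measure.pi fun e => bernoulliMeasure true false (q e)

/-- The Erdős–Rényi law `ER(N, p₀)`. -/
def preLaw (N : ℕ) (p₀ : I) : Measure (Graph N) := graphLaw fun _ => p₀

/-- The law of one graph after the change: connection probability `p₁` inside `V` and `p₀`
elsewhere. -/
def postLaw {N : ℕ} (p₀ p₁ : I) (V : Finset (Fin N)) : Measure (Graph N) :=
  graphLaw fun e => if Inside V e then p₁ else p₀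

/-- The no-change measure `ℙ_∞`: all graphs are independent with law `ER(N, p₀)`. -/
def lawInfty (N : ℕ) (p₀ : I) : Measure (GraphSeq N) :=
  Measure.infinitePi fun _ => preLaw N p₀

/-- The measure `ℙ_τ` (change-point `τ ≥ 1`, changed subgraph `V`): the graphs are independent,
with the pre-change law at times `t < τ` and the post-change law at times `t ≥ τ`. -/
def lawAt {N : ℕ} (p₀ p₁ : I) (V : Finset (Fin N)) (τ : ℕ) : Measure (GraphSeq N) :=
  Measure.infinitePi fun i => if i + 1 < τ then preLaw N p₀ else postLaw p₀ p₁ V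

/-- The filtration of the observations: `history N t` is generated by `G⁽¹⁾, …, G⁽ᵗ⁾`
(and is trivial for `t = 0`). -/
def history (N : ℕ) : Filtration ℕ (inferInstance : MeasurableSpace (GraphSeq N)) where
  seq t := ⨆ s ∈ Set.Icc 1 t, MeasurableSpace.comap (fun ω : GraphSeq N => obs ω s) inferInstance
  mono' _ _ h := biSup_mono fun _ hs => ⟨hs.1, hs.2.trans h⟩
  le' _ := iSup₂_le fun s _ =>
    Measurable.comap_le (by unfold obs; exact measurable_pi_apply (s - 1))

/-- The log-likelihood ratio `ℓ_V(G)` of a single graph. -/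
def logLR {N : ℕ} (p₀ p₁ : I) (V : Finset (Fin N)) (G : Graph N) : ℝ :=
  ∑ e : NodePair N with Inside V e,
    if G e then Real.log ((p₁ : ℝ) / p₀) else Real.log ((1 - (p₁ : ℝ)) / (1 - p₀))

/-- The log-likelihood ratio `R_{t,k,V}` of the samples `G⁽ᵏ⁾, …, G⁽ᵗ⁾`. -/
def R {N : ℕ} (p₀ p₁ : I) (ω : GraphSeq N) (t k : ℕ) (V : Finset (Fin N)) : ℝ :=
  ∑ s ∈ Finset.Icc k t, logLR p₀ p₁ V (obs ω s)

/-- The window-limited scan statistic at time `t`: the maximum of `R_{t,k,V}` over the candidate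
change-points `k ≥ 1` with `t - m ≤ k ≤ t - m'` and over the candidate subgraphs `V ∈ 𝒱`
(`⊥ = -∞` if there is no admissible `k`). -/
def scanStat {N : ℕ} (p₀ p₁ : I) (𝒱 : Finset (Finset (Fin N))) (m m' : ℕ) (ω : GraphSeq N)
    (t : ℕ) : WithBot ℝ :=
  ((Finset.Icc 1 t).filter fun k => t ≤ k + m ∧ k + m' ≤ t).sup fun k =>
    𝒱.sup fun V => (R p₀ p₁ ω t k V : WithBot ℝ)

/-- The window-limited GLR stopping time `T_G`: the first time `t ≥ 1` at which the scan statistic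
exceeds the threshold `b` (`⊤ = ∞` if this never happens). -/
def scanTime {N : ℕ} (p₀ p₁ : I) (𝒱 : Finset (Finset (Fin N))) (m m' : ℕ) (b : ℝ)
    (ω : GraphSeq N) : ℕ∞ :=
  ⨅ (t : ℕ) (_ : 1 ≤ t ∧ (b : WithBot ℝ) < scanStat p₀ p₁ 𝒱 m m' ω t), (t : ℕ∞)

/-- The average run length `𝔼_∞[T]`, possibly infinite. -/
def arl {N : ℕ} (p₀ : I) (T : GraphSeq N → ℕ∞) : ℝ≥0∞ :=
  ∫⁻ ω, (T ω : ℝ≥0∞) ∂(lawInfty N p₀)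

/-- Lorden's worst-case expected detection delay
`sup_{τ ≥ 1} ess sup 𝔼_τ[(T - τ)⁺ | G⁽¹⁾, …, G⁽τ⁻¹⁾]`, possibly infinite, when the changed
subgraph is `V`. The subtraction of extended natural numbers is truncated at `0`, which is the
positive part. -/
def edd {N : ℕ} (p₀ p₁ : I) (V : Finset (Fin N)) (T : GraphSeq N → ℕ∞) : ℝ≥0∞ :=
  ⨆ (τ : ℕ) (_ : 1 ≤ τ),
    essSup
      (condLExp (history N (τ - 1)) (lawAt p₀ p₁ V τ) fun ω => ((T ω - (τ : ℕ∞) : ℕ∞) : ℝ≥0∞))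
      (lawAt p₀ p₁ V τ)

/-- The smallest worst-case detection delay over all stopping times of the observations whose
average run length is at least `γ`. -/
def minEdd {N : ℕ} (p₀ p₁ : I) (V : Finset (Fin N)) (γ : ℝ≥0∞) : ℝ≥0∞ :=
  ⨅ (S : GraphSeq N → ℕ∞) (_ : IsStoppingTime (history N) S ∧ γ ≤ arl p₀ S), edd p₀ p₁ V S

/-- The Kullback–Leibler divergence between `ER(n, p₁)` and `ER(n, p₀)`. -/
def klInfo (n : ℕ) (p₀ p₁ : I) : ℝ :=
  (n.choose 2 : ℝ) * ((p₁ : ℝ) * Real.log ((p₁ : ℝ) / p₀)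
    + (1 - (p₁ : ℝ)) * Real.log ((1 - (p₁ : ℝ)) / (1 - p₀)))

/-- First-order asymptotic optimality, as `α → 0+`, of a family of detection procedures `T α` for a
change in the subgraph `V` with information number `J`: every `T α` is a stopping time, the average
run length `γ = 𝔼_∞[T α]` tends to infinity (being eventually finite), and the worst-case detection
delay of `T α` is `(1 + o(1)) (log γ) / J`, which is to first order the smallest worst-case detection
delay among all stopping times of average run length at least `γ`. -/
def IsFirstOrderOptimal {N : ℕ} (p₀ p₁ : I) (V : Finset (Fin N)) (J : ℝ)
    (T : ℝ → GraphSeq N → ℕ∞) : Prop :=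
  (∀ α ∈ Set.Ioo (0 : ℝ) 1, IsStoppingTime (history N) (T α)) ∧
  (∀ᶠ α in 𝓝[>] (0 : ℝ), arl p₀ (T α) ≠ ∞ ∧ edd p₀ p₁ V (T α) ≠ ∞) ∧
  Tendsto (fun α => (arl p₀ (T α)).toReal) (𝓝[>] 0) atTop ∧
  (fun α => (edd p₀ p₁ V (T α)).toReal)
    ~[𝓝[>] 0] (fun α => Real.log (arl p₀ (T α)).toReal / J) ∧
  (fun α => (minEdd p₀ p₁ V (arl p₀ (T α))).toReal)
    ~[𝓝[>] 0] (fun α => Real.log (arl p₀ (T α)).toReal / J)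

end GraphScan

end

open GraphScan

/-!
# Window-limited scan statistics for a change in a subgraph

All likelihood ratio arguments rest on one elementary fact. A single graph takes finitely many
values, so the history up to time `t` has finitely many atoms, and on each of them the density of
`ℙ_τ` with respect to `ℙ_∞` is `exp R_{t,τ,V}` (`lawAt_atom`, `measure_le_of_atom_le`).

*Average run length.* Splitting by the first passage time and changing the measure gives
`ℙ_∞(R_{t,k,V} > b for some t ≥ k) ≤ exp (-b)` (`lawInfty_exists_lt_R_le`). An alarm in a given
block of `m` consecutive times involves at most `2 m` start times `k`, hence has probability at most
`2 m |𝒱| exp (-b) ≤ α`. So with probability at least `1/2` there is no alarm in the first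
`⌊1 / (2 α)⌋` blocks (`le_arl_scanTime`).

*Delay of the scan.* After the change, cut time into blocks of length `L` slightly above `b / J`,
with `J` the Kullback–Leibler information. Such a block fits into the window, and the scan stops at
its end if its log-likelihood ratio exceeds `b`, which by Chebyshev's inequality has probability
tending to one. The blocks are independent of each other and of the past, so the number of blocks
until the alarm has a geometric tail conditionally on the past (`setLIntegral_tsub_le_of_blocks`),
and the delay is at most `(J⁻¹ + o(1)) b` (`eventually_edd_scanTime_le`). The same block argument
under `ℙ_∞`, with a tiny but positive success probability, shows that the average run length is
finite (`arl_scanTime_ne_top`).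

*Lower bound for every procedure.* If `𝔼_∞[S] ≥ exp x`, then for a block length `w` just below
`x / J` some block has conditional probability at most `2 w exp (-x)` of containing `S`, given that
`S` has not occurred before (`exists_block_measure_lt`): otherwise `S` would have a geometric tail
with too small a mean. If the change occurs at the start of that block, the likelihood ratio of the
block is at most `exp ((1 - δ) x)` with high probability, so the conditional probability of stopping
in the block stays small, and the delay is at least `(1 - o(1)) w` (`le_edd_of_lt_arl`,
`eventually_le_edd`).

Since `b ∼ |log α|` and `log 𝔼_∞[T_G] ≥ |log α| - O(1)`, the upper and the lower bound meet
(`isFirstOrderOptimal_of_edd_le`).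
-/

open GraphScan


noncomputable section

namespace GraphScan

variable {N : ℕ}

/-! ### Conditional expectations and block decompositions -/

/-- An extended natural number is at most `L` times the number of blocks of length `L` that it
reaches into. -/
lemma natCast_le_tsum_blocks (x : ℕ∞) {L : ℕ} (hL : 0 < L) :
    (x : ℝ≥0∞) ≤ ∑' j : ℕ, if ((j * L : ℕ) : ℕ∞) < x then (L : ℝ≥0∞) else 0 := by
  induction x using ENat.recTopCoe with
  | top =>
    simp only [ENat.natCast_lt_top, if_true]
    rw [ENNReal.tsum_const_eq_top_of_ne_zero (by exact_mod_cast hL.ne')]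
    exact le_top
  | coe a =>
    refine le_trans ?_ (ENNReal.sum_le_tsum (Finset.range ((a + L - 1) / L)))
    rw [Finset.sum_congr rfl (g := fun _ => (L : ℝ≥0∞))]
    · simp only [Finset.sum_const, Finset.card_range, nsmul_eq_mul]
      have h1 := Nat.div_add_mod (a + L - 1) L
      have h2 := Nat.mod_lt (a + L - 1) hL
      have : a ≤ (a + L - 1) / L * L := by rw [mul_comm]; omega
      exact_mod_cast this
    · intro j hj
      rw [Finset.mem_range, Nat.lt_div_iff_mul_lt hL] at hj
      rw [if_pos]
      exact_mod_cast (by omega : j * L < a)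

lemma essSup_condLExp_le {Ω : Type*} {m m₀ : MeasurableSpace Ω} (hm : m ≤ m₀) (μ : Measure[m₀] Ω)
    [IsProbabilityMeasure μ] (f : Ω → ℝ≥0∞) (c : ℝ≥0∞)
    (h : ∀ A, MeasurableSet[m] A → ∫⁻ ω in A, f ω ∂μ ≤ c * μ A) :
    essSup (condLExp m μ f) μ ≤ c := by
  refine essSup_le_of_ae_le _ ?_
  have : condLExp m μ f ≤ᵐ[μ.trim hm] fun _ => c := by
    refine ae_le_of_forall_setLIntegral_le_of_sigmaFinite (measurable_condLExp m μ f) ?_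
    intro s hs _
    rw [setLIntegral_condLExp_trim hm _ _ hs, lintegral_const, Measure.restrict_apply_univ,
      trim_measurableSet_eq hm hs]
    exact h s hs
  exact ae_le_of_ae_le_trim this

lemma le_essSup_condLExp {Ω : Type*} {m m₀ : MeasurableSpace Ω} (hm : m ≤ m₀) (μ : Measure[m₀] Ω)
    [IsProbabilityMeasure μ] (f : Ω → ℝ≥0∞) (c : ℝ≥0∞) {A : Set Ω} (hA : MeasurableSet[m] A)
    (hA0 : μ A ≠ 0) (h : c * μ A ≤ ∫⁻ ω in A, f ω ∂μ) :
    c ≤ essSup (condLExp m μ f) μ := by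
  have h1 : ∫⁻ ω in A, f ω ∂μ ≤ essSup (condLExp m μ f) μ * μ A := by
    rw [← setLIntegral_condLExp hm μ f hA, ← setLIntegral_const]
    exact lintegral_mono_ae (ae_restrict_of_ae (ENNReal.ae_le_essSup _))
  exact (ENNReal.mul_le_mul_iff_left hA0 (measure_ne_top μ A)).1 (h.trans h1)

/-! ### Likelihood ratios on finite histories -/

instance (q : NodePair N → I) : IsProbabilityMeasure (graphLaw q) := by
  unfold graphLaw; infer_instance

instance (p₀ : I) : IsProbabilityMeasure (preLaw N p₀) := by
  unfold preLaw; infer_instance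

instance (p₀ p₁ : I) (V : Finset (Fin N)) : IsProbabilityMeasure (postLaw p₀ p₁ V) := by
  unfold postLaw; infer_instance

/-- The laws of the single observations under `lawAt p₀ p₁ V τ`; index `i` stands for time
`i + 1`. -/
def lawSeq (p₀ p₁ : I) (V : Finset (Fin N)) (τ : ℕ) (i : ℕ) : Measure (Graph N) :=
  if i + 1 < τ then preLaw N p₀ else postLaw p₀ p₁ V

instance (p₀ p₁ : I) (V : Finset (Fin N)) (τ i : ℕ) :
    IsProbabilityMeasure (lawSeq p₀ p₁ V τ i) := by
  unfold lawSeq; split_ifs <;> infer_instance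

lemma lawAt_eq (p₀ p₁ : I) (V : Finset (Fin N)) (τ : ℕ) :
    lawAt p₀ p₁ V τ = Measure.infinitePi (lawSeq p₀ p₁ V τ) := rfl

instance (p₀ : I) : IsProbabilityMeasure (lawInfty N p₀) := by
  unfold lawInfty; infer_instance

instance (p₀ p₁ : I) (V : Finset (Fin N)) (τ : ℕ) : IsProbabilityMeasure (lawAt p₀ p₁ V τ) := by
  rw [lawAt_eq]; infer_instance

/-- The sequences of graphs that agree with `ω` up to time `t`: an atom of `history N t`. -/
def atom (ω : GraphSeq N) (t : ℕ) : Set (GraphSeq N) := {ω' | ∀ i < t, ω' i = ω i}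

lemma infinitePi_atom (ν : ℕ → Measure (Graph N)) [∀ i, IsProbabilityMeasure (ν i)]
    (ω : GraphSeq N) (t : ℕ) :
    Measure.infinitePi ν (atom ω t) = ∏ i ∈ Finset.range t, ν i {ω i} := by
  have : atom ω t = Set.pi (Finset.range t : Set ℕ) fun i => {ω i} := by
    ext ω'; simp [atom, Set.mem_pi]
  rw [this, Measure.infinitePi_pi _ fun _ _ => MeasurableSet.singleton _]

lemma measurable_obs {s t : ℕ} (hs : 1 ≤ s) (hst : s ≤ t) :
    Measurable[history N t] fun ω : GraphSeq N => obs ω s := by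
  have h : MeasurableSpace.comap (fun ω : GraphSeq N => obs ω s) inferInstance ≤ history N t :=
    le_iSup₂ (f := fun s (_ : s ∈ Set.Icc 1 t) =>
      MeasurableSpace.comap (fun ω : GraphSeq N => obs ω s) inferInstance) s ⟨hs, hst⟩
  exact (comap_measurable _).mono h le_rfl

lemma history_le_comap (t : ℕ) :
    (history N t : MeasurableSpace (GraphSeq N)) ≤
      MeasurableSpace.comap (fun ω (i : Fin t) => ω i) inferInstance := by
  refine iSup₂_le fun s hs => ?_
  have h1 := hs.1
  have h2 := hs.2
  rintro _ ⟨B, hB, rfl⟩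
  exact ⟨(fun x => x ⟨s - 1, by omega⟩) ⁻¹' B, (measurable_pi_apply (⟨s - 1, by omega⟩ : Fin t)) hB, rfl⟩

/-- Two measures on sequences of graphs can be compared on an event of the history up to time `t`
by comparing them on its atoms. -/
lemma measure_le_of_atom_le (μ₁ μ₂ : Measure (GraphSeq N)) (c : ℝ≥0∞) {t : ℕ}
    {A : Set (GraphSeq N)} (hA : MeasurableSet[history N t] A)
    (h : ∀ ω ∈ A, μ₁ (atom ω t) ≤ c * μ₂ (atom ω t)) : μ₁ A ≤ c * μ₂ A := by
  classical
  obtain ⟨B, -, rfl⟩ := history_le_comap t A hA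
  set f : GraphSeq N → Fin t → Graph N := fun ω i => ω i with hf
  have hfm : Measurable f := measurable_pi_lambda _ fun i => measurable_pi_apply _
  have hB : f ⁻¹' B = f ⁻¹' (B.toFinset : Set (Fin t → Graph N)) := by simp
  have hm : ∀ y ∈ B.toFinset, MeasurableSet (f ⁻¹' {y}) := fun y _ =>
    hfm (MeasurableSet.singleton y)
  rw [hB, ← sum_measure_preimage_singleton _ hm, ← sum_measure_preimage_singleton _ hm,
    Finset.mul_sum]
  refine Finset.sum_le_sum fun y hy => ?_
  obtain ⟨ω, rfl⟩ : ∃ ω, f ω = y :=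
    ⟨fun i => if hi : i < t then y ⟨i, hi⟩ else default, by ext1 i; simp [hf]⟩
  have hat : f ⁻¹' {f ω} = atom ω t := by
    ext ω'
    simp only [hf, Set.mem_preimage, Set.mem_singleton_iff, funext_iff (α := Fin t), atom,
      Set.mem_ofPred_eq]
    exact ⟨fun h i hi => h ⟨i, hi⟩, fun h i => h i i.2⟩
  rw [hat]
  exact h ω (by simpa using hy)

lemma bernoulliMeasure_singleton (p : I) (x : Bool) :
    bernoulliMeasure true false p {x} =
      ENNReal.ofReal (if x then (p : ℝ) else 1 - (p : ℝ)) := by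
  cases x
  · rw [bernoulliMeasure_apply_of_notMem_of_mem _ (MeasurableSet.singleton _) (by simp) (by simp)]
    rw [if_neg (by simp), ← unitInterval.coe_symm_eq, ENNReal.ofReal, ← unitInterval.coe_toNNReal,
      Real.toNNReal_coe]
  · rw [bernoulliMeasure_apply_of_mem_of_notMem _ (MeasurableSet.singleton _) (by simp) (by simp)]
    simp [ENNReal.ofReal, ← unitInterval.coe_toNNReal]

lemma graphLaw_singleton (q : NodePair N → I) (G : Graph N) :
    graphLaw q {G} = ∏ e, ENNReal.ofReal (if G e then (q e : ℝ) else 1 - (q e : ℝ)) := by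
  rw [graphLaw, Measure.pi_singleton]
  exact Finset.prod_congr rfl fun e _ => bernoulliMeasure_singleton _ _

lemma postLaw_singleton {p₀ p₁ : I} (hp₀ : 0 < p₀) (hp₀' : p₀ < 1) (hp₁ : 0 < p₁) (hp₁' : p₁ < 1)
    (V : Finset (Fin N)) (G : Graph N) :
    postLaw p₀ p₁ V {G} = ENNReal.ofReal (Real.exp (logLR p₀ p₁ V G)) * preLaw N p₀ {G} := by
  have h0 : (0 : ℝ) < p₀ := hp₀
  have h0' : (0 : ℝ) < 1 - p₀ := sub_pos.2 hp₀'
  have h1 : (0 : ℝ) < p₁ := hp₁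
  have h1' : (0 : ℝ) < 1 - p₁ := sub_pos.2 hp₁'
  rw [postLaw, preLaw, graphLaw_singleton, graphLaw_singleton, logLR, Finset.sum_filter,
    Real.exp_sum, ENNReal.ofReal_prod_of_nonneg fun _ _ => (Real.exp_pos _).le,
    ← Finset.prod_mul_distrib]
  refine Finset.prod_congr rfl fun e _ => ?_
  rw [← ENNReal.ofReal_mul (Real.exp_pos _).le]
  congr 1
  by_cases hV : Inside V e
  · rw [if_pos hV, if_pos hV]
    split_ifs
    · rw [Real.exp_log (div_pos h1 h0), div_mul_cancel₀ _ h0.ne']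
    · rw [Real.exp_log (div_pos h1' h0'), div_mul_cancel₀ _ h0'.ne']
  · rw [if_neg hV, if_neg hV, Real.exp_zero, one_mul]

lemma preLaw_singleton_pos {p₀ : I} (hp₀ : 0 < p₀) (hp₀' : p₀ < 1) (G : Graph N) :
    0 < preLaw N p₀ {G} := by
  rw [preLaw, graphLaw_singleton, pos_iff_ne_zero, Finset.prod_ne_zero_iff]
  intro e _
  rw [← pos_iff_ne_zero, ENNReal.ofReal_pos]
  split_ifs
  · exact hp₀
  · exact sub_pos.2 hp₀'

lemma R_succ (p₀ p₁ : I) (ω : GraphSeq N) {t k : ℕ} (h : k ≤ t + 1) (V : Finset (Fin N)) :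
    R p₀ p₁ ω (t + 1) k V = R p₀ p₁ ω t k V + logLR p₀ p₁ V (ω t) := by
  rw [R, Finset.sum_Icc_succ_top h]; rfl

lemma R_eq_zero (p₀ p₁ : I) (ω : GraphSeq N) {t k : ℕ} (h : t < k) (V : Finset (Fin N)) :
    R p₀ p₁ ω t k V = 0 := by
  rw [R, Finset.Icc_eq_empty_of_lt h, Finset.sum_empty]

/-- On the history up to time `t`, the likelihood ratio of `ℙ_τ` to `ℙ_∞` is `exp R_{t,τ,V}`. -/
lemma lawAt_atom {p₀ p₁ : I} (hp₀ : 0 < p₀) (hp₀' : p₀ < 1) (hp₁ : 0 < p₁) (hp₁' : p₁ < 1)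
    (V : Finset (Fin N)) {τ : ℕ} (hτ : 1 ≤ τ) (ω : GraphSeq N) (t : ℕ) :
    lawAt p₀ p₁ V τ (atom ω t) =
      ENNReal.ofReal (Real.exp (R p₀ p₁ ω t τ V)) * lawInfty N p₀ (atom ω t) := by
  rw [lawAt_eq, lawInfty, infinitePi_atom, infinitePi_atom]
  induction t with
  | zero => simp [R_eq_zero p₀ p₁ ω (show 0 < τ from hτ)]
  | succ t ih =>
    rw [Finset.prod_range_succ, Finset.prod_range_succ, ih, lawSeq]
    split_ifs with h
    · rw [R_eq_zero _ _ _ h, R_eq_zero _ _ _ (by omega)]; simp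
    · rw [R_succ _ _ _ (by omega), postLaw_singleton hp₀ hp₀' hp₁ hp₁', Real.exp_add,
        ENNReal.ofReal_mul (Real.exp_pos _).le]
      ring

lemma measurable_R (p₀ p₁ : I) {k s t : ℕ} (hk : 1 ≤ k) (hst : s ≤ t) (V : Finset (Fin N)) :
    Measurable[history N t] fun ω => R p₀ p₁ ω s k V := by
  unfold R
  refine Finset.measurable_sum _ fun i hi => ?_
  rw [Finset.mem_Icc] at hi
  exact (measurable_of_finite (logLR p₀ p₁ V)).comp (measurable_obs (by omega) (by omega))

lemma measurableSet_lt_R (p₀ p₁ : I) {k s t : ℕ} (hk : 1 ≤ k) (hst : s ≤ t) (V : Finset (Fin N))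
    (b : ℝ) : MeasurableSet[history N t] {ω | b < R p₀ p₁ ω s k V} :=
  measurable_R p₀ p₁ hk hst V measurableSet_Ioi

/-- The change of measure does not affect events before the change. -/
lemma lawAt_eq_lawInfty {p₀ p₁ : I} (hp₀ : 0 < p₀) (hp₀' : p₀ < 1) (hp₁ : 0 < p₁) (hp₁' : p₁ < 1)
    (V : Finset (Fin N)) {t : ℕ} {A : Set (GraphSeq N)} (hA : MeasurableSet[history N t] A) :
    lawAt p₀ p₁ V (t + 1) A = lawInfty N p₀ A := by
  have h : ∀ ω, lawAt p₀ p₁ V (t + 1) (atom ω t) = lawInfty N p₀ (atom ω t) := fun ω => by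
    rw [lawAt_atom hp₀ hp₀' hp₁ hp₁' V (by omega), R_eq_zero _ _ _ (by omega)]; simp
  apply le_antisymm
  · simpa using measure_le_of_atom_le _ _ 1 hA fun ω _ => by rw [h, one_mul]
  · simpa using measure_le_of_atom_le _ _ 1 hA fun ω _ => by rw [h, one_mul]

/-- Maximal inequality for the likelihood ratio process: the event is split according to the first
passage time, and each part is compared with its probability under the changed measure. -/
lemma lawInfty_exists_lt_R_le {p₀ p₁ : I} (hp₀ : 0 < p₀) (hp₀' : p₀ < 1) (hp₁ : 0 < p₁)
    (hp₁' : p₁ < 1) (V : Finset (Fin N)) {k : ℕ} (hk : 1 ≤ k) (u : ℕ) (b : ℝ) :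
    lawInfty N p₀ {ω | ∃ t ∈ Finset.Icc k u, b < R p₀ p₁ ω t k V} ≤
      ENNReal.ofReal (Real.exp (-b)) := by
  set A : ℕ → Set (GraphSeq N) := fun t =>
    {ω | b < R p₀ p₁ ω t k V ∧ ∀ s ∈ Finset.Ico k t, ¬ b < R p₀ p₁ ω s k V} with hAdef
  have hA : ∀ t, MeasurableSet[history N t] (A t) := by
    intro t
    have : A t = {ω | b < R p₀ p₁ ω t k V} ∩
        ⋂ s ∈ Finset.Ico k t, {ω | b < R p₀ p₁ ω s k V}ᶜ := by
      ext ω; simp [hAdef]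
    rw [this]
    refine (measurableSet_lt_R p₀ p₁ hk le_rfl V b).inter ?_
    refine Finset.measurableSet_biInter _ fun s hs => ?_
    exact (measurableSet_lt_R p₀ p₁ hk (Finset.mem_Ico.1 hs).2.le V b).compl
  have hA' : ∀ t, MeasurableSet (A t) := fun t => (history N).le t _ (hA t)
  have hsub : {ω | ∃ t ∈ Finset.Icc k u, b < R p₀ p₁ ω t k V} ⊆ ⋃ t ∈ Finset.Icc k u, A t := by
    rintro ω ⟨t, ht, htb⟩
    classical
    have hex : ∃ t, k ≤ t ∧ b < R p₀ p₁ ω t k V := ⟨t, (Finset.mem_Icc.1 ht).1, htb⟩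
    have hle : Nat.find hex ≤ t := Nat.find_min' hex ⟨(Finset.mem_Icc.1 ht).1, htb⟩
    obtain ⟨h1, h2⟩ := Nat.find_spec hex
    refine Set.mem_iUnion₂.2
      ⟨Nat.find hex, Finset.mem_Icc.2 ⟨h1, hle.trans (Finset.mem_Icc.1 ht).2⟩, h2, ?_⟩
    intro s hs hsb
    rw [Finset.mem_Ico] at hs
    exact Nat.find_min hex hs.2 ⟨hs.1, hsb⟩
  have hdisj : Set.PairwiseDisjoint (Finset.Icc k u : Set ℕ) A := by
    intro s hs t ht hst
    refine Set.disjoint_left.2 fun ω hs' ht' => ?_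
    rcases lt_or_gt_of_ne hst with h | h
    · exact ht'.2 s (Finset.mem_Ico.2 ⟨(Finset.mem_Icc.1 hs).1, h⟩) hs'.1
    · exact hs'.2 t (Finset.mem_Ico.2 ⟨(Finset.mem_Icc.1 ht).1, h⟩) ht'.1
  have hcomp : ∀ t, lawInfty N p₀ (A t) ≤
      ENNReal.ofReal (Real.exp (-b)) * lawAt p₀ p₁ V k (A t) := by
    intro t
    refine measure_le_of_atom_le _ _ _ (hA t) fun ω hω => ?_
    rw [lawAt_atom hp₀ hp₀' hp₁ hp₁' V hk, ← mul_assoc, ← ENNReal.ofReal_mul (Real.exp_pos _).le,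
      ← Real.exp_add]
    have h1 : (1 : ℝ≥0∞) ≤ ENNReal.ofReal (Real.exp (-b + R p₀ p₁ ω t k V)) := by
      rw [ENNReal.one_le_ofReal, Real.one_le_exp_iff]
      have := hω.1
      linarith
    simpa using mul_le_mul_left h1 (lawInfty N p₀ (atom ω t))
  calc lawInfty N p₀ {ω | ∃ t ∈ Finset.Icc k u, b < R p₀ p₁ ω t k V}
      ≤ lawInfty N p₀ (⋃ t ∈ Finset.Icc k u, A t) := measure_mono hsub
    _ ≤ ∑ t ∈ Finset.Icc k u, lawInfty N p₀ (A t) := measure_biUnion_finset_le _ _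
    _ ≤ ∑ t ∈ Finset.Icc k u, ENNReal.ofReal (Real.exp (-b)) * lawAt p₀ p₁ V k (A t) :=
        Finset.sum_le_sum fun t _ => hcomp t
    _ = ENNReal.ofReal (Real.exp (-b)) * lawAt p₀ p₁ V k (⋃ t ∈ Finset.Icc k u, A t) := by
        rw [measure_biUnion_finset hdisj fun t _ => hA' t, Finset.mul_sum]
    _ ≤ ENNReal.ofReal (Real.exp (-b)) := mul_le_of_le_one_right' prob_le_one

/-! ### The scan statistic and its average run length -/

lemma lt_scanStat_iff (p₀ p₁ : I) (𝒱 : Finset (Finset (Fin N))) (m m' : ℕ) (b : ℝ)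
    (ω : GraphSeq N) (t : ℕ) :
    (b : WithBot ℝ) < scanStat p₀ p₁ 𝒱 m m' ω t ↔
      ∃ k, (1 ≤ k ∧ t ≤ k + m ∧ k + m' ≤ t) ∧ ∃ V ∈ 𝒱, b < R p₀ p₁ ω t k V := by
  simp only [scanStat, Finset.lt_sup_iff, Finset.mem_filter, Finset.mem_Icc, WithBot.coe_lt_coe]
  constructor
  · rintro ⟨k, ⟨⟨h1, -⟩, h2⟩, h⟩
    exact ⟨k, ⟨h1, h2⟩, h⟩
  · rintro ⟨k, ⟨h1, h2⟩, h⟩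
    exact ⟨k, ⟨⟨h1, by omega⟩, h2⟩, h⟩

lemma scanTime_le_iff (p₀ p₁ : I) (𝒱 : Finset (Finset (Fin N))) (m m' : ℕ) (b : ℝ)
    (ω : GraphSeq N) (t : ℕ) :
    scanTime p₀ p₁ 𝒱 m m' b ω ≤ t ↔
      ∃ s ∈ Finset.Icc 1 t, ∃ k, (1 ≤ k ∧ s ≤ k + m ∧ k + m' ≤ s) ∧
        ∃ V ∈ 𝒱, b < R p₀ p₁ ω s k V := by
  simp only [← lt_scanStat_iff, Finset.mem_Icc]
  constructor
  · intro h
    by_contra! hcon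
    have h1 : ((t + 1 : ℕ) : ℕ∞) ≤ scanTime p₀ p₁ 𝒱 m m' b ω := by
      refine le_iInf₂ fun s hs => ?_
      by_contra! hlt
      have : s < t + 1 := by exact_mod_cast hlt
      exact absurd hs.2 (hcon s ⟨hs.1, by omega⟩).not_gt
    have := h1.trans h
    norm_cast at this
    omega
  · rintro ⟨s, ⟨h1, h2⟩, h⟩
    exact iInf₂_le_of_le s ⟨h1, h⟩ (by exact_mod_cast h2)

lemma isStoppingTime_scanTime (p₀ p₁ : I) (𝒱 : Finset (Finset (Fin N))) (m m' : ℕ) (b : ℝ) :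
    IsStoppingTime (history N) (scanTime p₀ p₁ 𝒱 m m' b) := by
  intro t
  have : {ω | scanTime p₀ p₁ 𝒱 m m' b ω ≤ (t : ℕ∞)} =
      ⋃ s ∈ Finset.Icc 1 t, ⋃ k, ⋃ (_ : 1 ≤ k ∧ s ≤ k + m ∧ k + m' ≤ s),
        ⋃ V ∈ 𝒱, {ω | b < R p₀ p₁ ω s k V} := by
    ext ω
    simp only [Set.mem_ofPred_eq, scanTime_le_iff, Set.mem_iUnion, exists_prop]
  change MeasurableSet[history N t] {ω | scanTime p₀ p₁ 𝒱 m m' b ω ≤ (t : ℕ∞)}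
  rw [this]
  refine Finset.measurableSet_biUnion _ fun s hs => MeasurableSet.iUnion fun k =>
    MeasurableSet.iUnion fun hk => Finset.measurableSet_biUnion _ fun V _ =>
      measurableSet_lt_R p₀ p₁ hk.1 (Finset.mem_Icc.1 hs).2 V b

lemma measurableSet_lt_stoppingTime {S : GraphSeq N → ℕ∞} (hS : IsStoppingTime (history N) S)
    (t : ℕ) : MeasurableSet[history N t] {ω | (t : ℕ∞) < S ω} := by
  have h : MeasurableSet[history N t] {ω | S ω ≤ (t : ℕ∞)} := hS t
  convert! h.compl using 1
  ext ω
  simp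

/-- An alarm in the first `J` blocks of length `m` has probability at most `2 m J |𝒱| exp (-b)`:
an alarm in one block involves at most `2 m` candidate change-points. -/
lemma lawInfty_scanTime_le {p₀ p₁ : I} (hp₀ : 0 < p₀) (hp₀' : p₀ < 1) (hp₁ : 0 < p₁)
    (hp₁' : p₁ < 1) (𝒱 : Finset (Finset (Fin N))) {m : ℕ} (hm : 1 ≤ m) (m' : ℕ) (b : ℝ) (J : ℕ) :
    lawInfty N p₀ {ω | scanTime p₀ p₁ 𝒱 m m' b ω ≤ ((J * m : ℕ) : ℕ∞)} ≤
      J * (2 * m * (𝒱.card * ENNReal.ofReal (Real.exp (-b)))) := by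
  set K : ℕ → Finset ℕ := fun j => Finset.Icc (max 1 (j * m + 1 - m)) (j * m + m) with hK
  have hcard : ∀ j, (K j).card ≤ 2 * m := by
    intro j
    rw [hK]
    simp only [Nat.card_Icc]
    omega
  have hsub : {ω | scanTime p₀ p₁ 𝒱 m m' b ω ≤ ((J * m : ℕ) : ℕ∞)} ⊆
      ⋃ j ∈ Finset.range J, ⋃ k ∈ K j, ⋃ V ∈ 𝒱,
        {ω | ∃ t ∈ Finset.Icc k (j * m + m), b < R p₀ p₁ ω t k V} := by
    intro ω hω
    rw [Set.mem_ofPred_eq, scanTime_le_iff] at hω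
    obtain ⟨s, hs, k, ⟨hk1, hk2, hk3⟩, V, hV, hb⟩ := hω
    rw [Finset.mem_Icc] at hs
    -- the block `j` with `j m < s ≤ (j + 1) m`
    have h1 := Nat.div_add_mod (s - 1) m
    have h2 := Nat.mod_lt (s - 1) hm
    rw [mul_comm] at h1
    have hj : (s - 1) / m < J := by rw [Nat.div_lt_iff_lt_mul hm]; omega
    simp only [Set.mem_iUnion, exists_prop]
    refine ⟨(s - 1) / m, Finset.mem_range.2 hj, k, ?_, V, hV, s, ?_, hb⟩
    · simp only [hK, Finset.mem_Icc]; omega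
    · rw [Finset.mem_Icc]; omega
  have hK1 : ∀ j, ∀ k ∈ K j, 1 ≤ k := fun j k hk =>
    (le_max_left _ _).trans (Finset.mem_Icc.1 hk).1
  refine (measure_mono hsub).trans ((measure_biUnion_finset_le _ _).trans ?_)
  refine (Finset.sum_le_card_nsmul _ _ _ fun j _ => ?_).trans
    (by rw [Finset.card_range, nsmul_eq_mul])
  refine (measure_biUnion_finset_le _ _).trans ?_
  refine (Finset.sum_le_card_nsmul _ _ (𝒱.card * ENNReal.ofReal (Real.exp (-b)))
    fun k hk => ?_).trans ?_
  · refine (measure_biUnion_finset_le _ _).trans ?_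
    refine (Finset.sum_le_card_nsmul _ _ _ fun V _ => ?_).trans (by rw [nsmul_eq_mul])
    exact lawInfty_exists_lt_R_le hp₀ hp₀' hp₁ hp₁' V (hK1 j k hk) _ b
  · rw [nsmul_eq_mul]
    gcongr
    exact_mod_cast hcard j

/-- The bound on the average run length: by `lawInfty_scanTime_le`, with probability at least `1/2`
there is no alarm in the first `⌊1 / (2 α)⌋` blocks of length `m`. -/
lemma le_arl_scanTime {p₀ p₁ : I} (hp₀ : 0 < p₀) (hp₀' : p₀ < 1) (hp₁ : 0 < p₁)
    (hp₁' : p₁ < 1) (𝒱 : Finset (Finset (Fin N))) {m : ℕ} (hm : 1 ≤ m) (m' : ℕ) (b : ℝ)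
    {α : ℝ} (hα : α ∈ Set.Ioo (0 : ℝ) 1) (hb : 2 * (m : ℝ) * Real.exp (-b) * 𝒱.card ≤ α) :
    ENNReal.ofReal ((1 / 2 - α) * ((m : ℝ) / (2 * α) - 1)) ≤
      arl p₀ (scanTime p₀ p₁ 𝒱 m m' b) := by
  set T := scanTime p₀ p₁ 𝒱 m m' b with hT
  set J : ℕ := ⌊1 / (2 * α)⌋₊ with hJ
  have hα0 : 0 < α := hα.1
  have hJ1 : (J : ℝ) * α ≤ 1 / 2 := by
    have := Nat.floor_le (show 0 ≤ 1 / (2 * α) by positivity)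
    calc (J : ℝ) * α ≤ 1 / (2 * α) * α := by gcongr
      _ = 1 / 2 := by field_simp
  have hJ2 : 1 / (2 * α) < J + 1 := Nat.lt_floor_add_one _
  have hB : MeasurableSet {ω | ((J * m : ℕ) : ℕ∞) < T ω} := (history N).le _ _
    (measurableSet_lt_stoppingTime (isStoppingTime_scanTime p₀ p₁ 𝒱 m m' b) _)
  have hfail : lawInfty N p₀ {ω | ((J * m : ℕ) : ℕ∞) < T ω}ᶜ ≤ ENNReal.ofReal (1 / 2) := by
    have : {ω | ((J * m : ℕ) : ℕ∞) < T ω}ᶜ = {ω | T ω ≤ ((J * m : ℕ) : ℕ∞)} := by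
      ext ω; simp
    rw [this]
    refine (lawInfty_scanTime_le hp₀ hp₀' hp₁ hp₁' 𝒱 hm m' b J).trans ?_
    rw [show (J : ℝ≥0∞) * (2 * m * (𝒱.card * ENNReal.ofReal (Real.exp (-b)))) =
      ENNReal.ofReal (J * (2 * m * (𝒱.card * Real.exp (-b)))) by
        rw [ENNReal.ofReal_mul (by positivity), ENNReal.ofReal_mul (by positivity),
          ENNReal.ofReal_mul (by positivity), ENNReal.ofReal_mul (by positivity)]
        simp]
    refine ENNReal.ofReal_le_ofReal (le_trans ?_ hJ1)
    gcongr
    linarith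
  have hhalf : ENNReal.ofReal (1 / 2) ≤ lawInfty N p₀ {ω | ((J * m : ℕ) : ℕ∞) < T ω} := by
    have h1 := prob_add_prob_compl (μ := lawInfty N p₀) hB
    by_contra! hlt
    have h2 := ENNReal.add_lt_add_of_lt_of_le (by simp) hlt hfail
    rw [h1, ← ENNReal.ofReal_add (by norm_num) (by norm_num)] at h2
    norm_num at h2
  have hint : ((J * m + 1 : ℕ) : ℝ≥0∞) * lawInfty N p₀ {ω | ((J * m : ℕ) : ℕ∞) < T ω} ≤
      arl p₀ T := by
    rw [← lintegral_indicator_const hB]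
    refine lintegral_mono fun ω => ?_
    by_cases hω : ω ∈ {ω | ((J * m : ℕ) : ℕ∞) < T ω}
    swap
    · rw [Set.indicator_of_notMem hω]; exact zero_le
    rw [Set.indicator_of_mem hω]
    have : ((J * m + 1 : ℕ) : ℕ∞) ≤ T ω := by
      have := Order.add_one_le_of_lt (show ((J * m : ℕ) : ℕ∞) < T ω from hω)
      exact_mod_cast this
    calc ((J * m + 1 : ℕ) : ℝ≥0∞) = (((J * m + 1 : ℕ) : ℕ∞) : ℝ≥0∞) := by simp
      _ ≤ _ := ENat.toENNReal_le.2 this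
  refine le_trans ?_ ((mul_le_mul_right hhalf _).trans hint)
  rw [← ENNReal.ofReal_natCast, ← ENNReal.ofReal_mul (by positivity)]
  refine ENNReal.ofReal_le_ofReal ?_
  have hm1 : (1 : ℝ) ≤ m := by exact_mod_cast hm
  have hexp : (1 / 2 - α) * ((m : ℝ) / (2 * α) - 1) =
      (1 / (2 * α)) * m * (1 / 2) - m / 2 - 1 / 2 + α := by field_simp; ring
  rw [hexp]
  push_cast
  have := mul_le_mul_of_nonneg_right hJ2.le (show (0 : ℝ) ≤ m by positivity)
  have := hα.2
  linarith

/-! ### Independence of past and future -/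

/-- The σ-algebra of the observations after time `t`. -/
abbrev future (N t : ℕ) : MeasurableSpace (GraphSeq N) :=
  ⨆ i ∈ Set.Ici t, MeasurableSpace.comap (fun ω : GraphSeq N => ω i) inferInstance

lemma measurable_obs_future {s t : ℕ} (h : t < s) :
    Measurable[future N t] fun ω : GraphSeq N => obs ω s := by
  have h1 : MeasurableSpace.comap (fun ω : GraphSeq N => ω (s - 1)) inferInstance ≤ future N t :=
    le_iSup₂ (f := fun i (_ : i ∈ Set.Ici t) =>
      MeasurableSpace.comap (fun ω : GraphSeq N => ω i) inferInstance) (s - 1)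
      (by simp only [Set.mem_Ici]; omega)
  exact (comap_measurable _).mono h1 le_rfl

lemma measurable_R_future (p₀ p₁ : I) {k t : ℕ} (hk : t < k) (s : ℕ) (V : Finset (Fin N)) :
    Measurable[future N t] fun ω => R p₀ p₁ ω s k V := by
  unfold R
  refine Finset.measurable_sum _ fun i hi => ?_
  rw [Finset.mem_Icc] at hi
  exact (measurable_of_finite (logLR p₀ p₁ V)).comp (measurable_obs_future (by omega))

lemma indep_history_future (ν : ℕ → Measure (Graph N)) [∀ i, IsProbabilityMeasure (ν i)] (t : ℕ) :
    Indep (history N t) (future N t) (Measure.infinitePi ν) := by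
  have h1 : iIndepFun (fun i (ω : GraphSeq N) => ω i) (Measure.infinitePi ν) :=
    iIndepFun_infinitePi (X := fun _ x => x) fun _ => measurable_id
  have h2 := indep_iSup_of_disjoint (S := Set.Iio t) (T := Set.Ici t)
    (fun i => (measurable_pi_apply i).comap_le) h1
    (Set.disjoint_left.2 fun i hi hi' => not_le_of_gt (Set.mem_Iio.1 hi) (Set.mem_Ici.1 hi'))
  refine indep_of_indep_of_le_left h2 (iSup₂_le fun s hs => ?_)
  have := hs.1
  have := hs.2
  exact le_iSup₂ (f := fun i (_ : i ∈ Set.Iio t) =>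
      MeasurableSpace.comap (fun ω : GraphSeq N => ω i) inferInstance) (s - 1)
      (by simp only [Set.mem_Iio]; omega)

lemma measure_inter_future (ν : ℕ → Measure (Graph N)) [∀ i, IsProbabilityMeasure (ν i)] {t : ℕ}
    {A B : Set (GraphSeq N)} (hA : MeasurableSet[history N t] A) (hB : MeasurableSet[future N t] B) :
    Measure.infinitePi ν (A ∩ B) = Measure.infinitePi ν A * Measure.infinitePi ν B :=
  (Indep_iff _ _ _).1 (indep_history_future ν t) A B hA hB

section Blocks

variable (ν : ℕ → Measure (Graph N)) [∀ i, IsProbabilityMeasure (ν i)] {T : GraphSeq N → ℕ∞}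
  (hT : IsStoppingTime (history N) T) (t₀ L : ℕ) (B : ℕ → Set (GraphSeq N)) (q : ℝ≥0∞)
  (hB : ∀ j, MeasurableSet[future N (t₀ + j * L)] (B j))
  (hBq : ∀ j, Measure.infinitePi ν (B j) ≤ q)
  (hTB : ∀ j ω, ((t₀ + (j + 1) * L : ℕ) : ℕ∞) < T ω → ω ∈ B j)
  {A : Set (GraphSeq N)} (hA : MeasurableSet[history N t₀] A)

include hT hB hBq hTB hA

lemma measure_inter_lt_le_pow (j : ℕ) :
    Measure.infinitePi ν (A ∩ {ω | ((t₀ + j * L : ℕ) : ℕ∞) < T ω}) ≤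
      q ^ j * Measure.infinitePi ν A := by
  induction j with
  | zero => simpa using measure_mono Set.inter_subset_left
  | succ j ih =>
    have hsub : A ∩ {ω | ((t₀ + (j + 1) * L : ℕ) : ℕ∞) < T ω} ⊆
        (A ∩ {ω | ((t₀ + j * L : ℕ) : ℕ∞) < T ω}) ∩ B j := by
      rintro ω ⟨h1, h2⟩
      refine ⟨⟨h1, Set.mem_ofPred_eq.symm ▸ lt_of_le_of_lt ?_ h2⟩, hTB j ω h2⟩
      exact_mod_cast (by nlinarith : t₀ + j * L ≤ t₀ + (j + 1) * L)
    refine (measure_mono hsub).trans ?_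
    rw [measure_inter_future ν _ (hB j), pow_succ, mul_right_comm]
    · exact mul_le_mul' ih (hBq j)
    · exact ((history N).mono (Nat.le_add_right _ _) _ hA).inter
        (measurableSet_lt_stoppingTime hT _)

/-- If `T` exceeds the end of a block only when an event `B j` determined by that block occurs, then
the number of blocks until `T` has a geometric tail, also conditionally on the past. -/
lemma setLIntegral_tsub_le_of_blocks (hL : 0 < L) :
    ∫⁻ ω in A, ((T ω - (t₀ : ℕ∞) : ℕ∞) : ℝ≥0∞) ∂(Measure.infinitePi ν) ≤
      L * (1 - q)⁻¹ * Measure.infinitePi ν A := by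
  set D : ℕ → Set (GraphSeq N) := fun j => {ω | ((t₀ + j * L : ℕ) : ℕ∞) < T ω} with hD
  have hDm : ∀ j, MeasurableSet (D j) := fun j =>
    (history N).le _ _ (measurableSet_lt_stoppingTime hT _)
  have hpt : ∀ ω, ((T ω - (t₀ : ℕ∞) : ℕ∞) : ℝ≥0∞) ≤
      ∑' j, (D j).indicator (fun _ => (L : ℝ≥0∞)) ω := by
    intro ω
    refine (natCast_le_tsum_blocks _ hL).trans (ENNReal.tsum_le_tsum fun j => ?_)
    rw [Set.indicator_apply]
    have : ((j * L : ℕ) : ℕ∞) < T ω - t₀ ↔ ω ∈ D j := by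
      rw [lt_tsub_iff_left]
      simp [hD]
    simp only [this, le_refl]
  calc ∫⁻ ω in A, ((T ω - (t₀ : ℕ∞) : ℕ∞) : ℝ≥0∞) ∂(Measure.infinitePi ν)
      ≤ ∫⁻ ω in A, ∑' j, (D j).indicator (fun _ => (L : ℝ≥0∞)) ω ∂(Measure.infinitePi ν) :=
        lintegral_mono hpt
    _ = ∑' j, L * Measure.infinitePi ν (A ∩ D j) := by
        rw [lintegral_tsum fun j => (measurable_const.indicator (hDm j)).aemeasurable]
        refine tsum_congr fun j => ?_
        rw [lintegral_indicator_const (hDm j), Measure.restrict_apply (hDm j), Set.inter_comm]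
    _ ≤ ∑' j, L * (q ^ j * Measure.infinitePi ν A) :=
        ENNReal.tsum_le_tsum fun j => mul_le_mul_right
          (measure_inter_lt_le_pow ν hT t₀ L B q hB hBq hTB hA j) _
    _ = L * (1 - q)⁻¹ * Measure.infinitePi ν A := by
        rw [ENNReal.tsum_mul_left, ENNReal.tsum_mul_right, ENNReal.tsum_geometric, mul_assoc]

end Blocks

/-! ### Moments of the log-likelihood ratio -/

lemma card_filter_inside (V : Finset (Fin N)) :
    (Finset.univ.filter fun e : NodePair N => Inside V e).card = V.card.choose 2 := by
  rw [← Finset.card_powersetCard]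
  refine Finset.card_bij (fun e _ => {e.1.1, e.1.2}) ?_ ?_ ?_
  · rintro ⟨⟨i, j⟩, hij⟩ he
    simp only [Finset.mem_filter, Finset.mem_univ, true_and] at he
    rw [Finset.mem_powersetCard]
    refine ⟨?_, Finset.card_pair (ne_of_lt hij)⟩
    intro x hx
    simp only [Finset.mem_insert, Finset.mem_singleton] at hx
    rcases hx with rfl | rfl
    exacts [he.1, he.2]
  · rintro ⟨⟨i, j⟩, hij⟩ - ⟨⟨k, l⟩, hkl⟩ - h
    simp only at hij hkl h
    have h1 : i ∈ ({k, l} : Finset (Fin N)) := h ▸ Finset.mem_insert_self _ _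
    have h2 : j ∈ ({k, l} : Finset (Fin N)) := h ▸ by simp
    simp only [Finset.mem_insert, Finset.mem_singleton] at h1 h2
    rcases h1 with rfl | rfl <;> rcases h2 with rfl | rfl
    · exact absurd hij (lt_irrefl _)
    · rfl
    · exact absurd hij hkl.not_gt
    · exact absurd hij (lt_irrefl _)
  · intro s hs
    rw [Finset.mem_powersetCard] at hs
    obtain ⟨i, j, hij, rfl⟩ := Finset.card_eq_two.1 hs.2
    have hi : i ∈ V := hs.1 (by simp)
    have hj : j ∈ V := hs.1 (by simp)
    rcases lt_or_gt_of_ne hij with h | h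
    · exact ⟨⟨(i, j), h⟩, Finset.mem_filter.2 ⟨Finset.mem_univ _, hi, hj⟩, rfl⟩
    · exact ⟨⟨(j, i), h⟩, Finset.mem_filter.2 ⟨Finset.mem_univ _, hj, hi⟩, Finset.pair_comm _ _⟩

lemma integral_logLR (p₀ p₁ : I) (V : Finset (Fin N)) :
    ∫ G, logLR p₀ p₁ V G ∂(postLaw p₀ p₁ V) = klInfo V.card p₀ p₁ := by
  unfold logLR
  rw [integral_finsetSum _ fun e _ => Integrable.of_finite]
  rw [Finset.sum_congr rfl (g := fun _ => (p₁ : ℝ) * Real.log ((p₁ : ℝ) / p₀)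
    + (1 - (p₁ : ℝ)) * Real.log ((1 - (p₁ : ℝ)) / (1 - p₀)))]
  · rw [Finset.sum_const, card_filter_inside, nsmul_eq_mul, klInfo]
  · intro e he
    have h := integral_comp_eval (X := fun _ : NodePair N => Bool)
      (μ := fun e => bernoulliMeasure true false (if Inside V e then p₁ else p₀)) (i := e)
      (f := fun x : Bool => if x then Real.log ((p₁ : ℝ) / p₀)
        else Real.log ((1 - (p₁ : ℝ)) / (1 - p₀)))
      (measurable_of_finite _).aestronglyMeasurable
    rw [if_pos (Finset.mem_filter.1 he).2, integral_bernoulliMeasure] at h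
    rw [postLaw, graphLaw]
    refine h.trans ?_
    simp

lemma klInfo_pos {n : ℕ} (hn : 2 ≤ n) {p₀ p₁ : I} (hp₀ : 0 < p₀) (hp₀' : p₀ < 1) (hp₁ : 0 < p₁)
    (hp₁' : p₁ < 1) (hne : p₁ ≠ p₀) : 0 < klInfo n p₀ p₁ := by
  have h0 : (0 : ℝ) < p₀ := hp₀
  have h0' : (0 : ℝ) < 1 - p₀ := sub_pos.2 hp₀'
  have h1 : (0 : ℝ) < p₁ := hp₁
  have h1' : (0 : ℝ) < 1 - p₁ := sub_pos.2 hp₁'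
  have hne' : (p₁ : ℝ) ≠ p₀ := fun h => hne (Subtype.ext h)
  refine mul_pos (by exact_mod_cast Nat.choose_pos hn) ?_
  have key : ∀ x y : ℝ, 0 < x → 0 < y → x ≠ y → x - y < x * Real.log (x / y) := by
    intro x y hx hy hxy
    have h := Real.log_lt_sub_one_of_pos (div_pos hy hx)
      (fun h => hxy ((div_eq_one_iff_eq hx.ne').1 h).symm)
    have h2 : Real.log (x / y) = - Real.log (y / x) := by rw [← Real.log_inv, inv_div]
    rw [h2]
    have h3 := mul_lt_mul_of_pos_left h hx
    have h4 : x * (y / x - 1) = y - x := by field_simp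
    linarith
  have a := key _ _ h1 h0 hne'
  have b := key _ _ h1' h0' (fun h => hne' (by linarith))
  linarith

lemma measurePreserving_obs {p₀ p₁ : I} (V : Finset (Fin N)) {τ s : ℕ} (hs : 1 ≤ s) (h : τ ≤ s) :
    MeasurePreserving (fun ω : GraphSeq N => obs ω s) (lawAt p₀ p₁ V τ) (postLaw p₀ p₁ V) := by
  have h1 := measurePreserving_eval_infinitePi (lawSeq p₀ p₁ V τ) (s - 1)
  have h2 : lawSeq p₀ p₁ V τ (s - 1) = postLaw p₀ p₁ V := by
    rw [lawSeq, if_neg (by omega)]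
  rw [h2] at h1
  exact h1

/-- Chebyshev's inequality for the log-likelihood ratio of a stretch of observations after the
change. -/
lemma lawAt_abs_R_sub_ge (p₀ p₁ : I) (V : Finset (Fin N)) {τ k : ℕ} (hk : 1 ≤ k) (hτ : τ ≤ k)
    (t : ℕ) {c : ℝ} (hc : 0 < c) :
    lawAt p₀ p₁ V τ {ω | c ≤ |R p₀ p₁ ω t k V - (t + 1 - k : ℕ) * klInfo V.card p₀ p₁|} ≤
      ENNReal.ofReal ((t + 1 - k : ℕ) *
        variance (logLR p₀ p₁ V) (postLaw p₀ p₁ V) / c ^ 2) := by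
  set X : ℕ → GraphSeq N → ℝ := fun s ω => logLR p₀ p₁ V (obs ω s) with hX
  have hR : (fun ω => R p₀ p₁ ω t k V) = ∑ s ∈ Finset.Icc k t, X s := by
    ext ω; simp [R, hX]
  have hmp : ∀ s ∈ Finset.Icc k t, MeasurePreserving (fun ω : GraphSeq N => obs ω s)
      (lawAt p₀ p₁ V τ) (postLaw p₀ p₁ V) := fun s hs =>
    measurePreserving_obs V (hk.trans (Finset.mem_Icc.1 hs).1) (hτ.trans (Finset.mem_Icc.1 hs).1)
  have hml : Measurable (logLR p₀ p₁ V) := measurable_of_finite _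
  have hL2 : MemLp (logLR p₀ p₁ V) 2 (postLaw p₀ p₁ V) := MemLp.of_discrete
  have hX2 : ∀ s ∈ Finset.Icc k t, MemLp (X s) 2 (lawAt p₀ p₁ V τ) := fun s hs =>
    hL2.comp_measurePreserving (hmp s hs)
  have hmean : ∫ ω, R p₀ p₁ ω t k V ∂(lawAt p₀ p₁ V τ) =
      (t + 1 - k : ℕ) * klInfo V.card p₀ p₁ := by
    have : ∀ ω, R p₀ p₁ ω t k V = ∑ s ∈ Finset.Icc k t, X s ω := fun ω => rfl
    simp_rw [this]
    rw [integral_finsetSum _ fun s hs => (hX2 s hs).integrable (by norm_num)]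
    rw [Finset.sum_congr rfl (g := fun _ => klInfo V.card p₀ p₁), Finset.sum_const,
      Nat.card_Icc, nsmul_eq_mul]
    intro s hs
    rw [← integral_logLR, ← (hmp s hs).map_eq, integral_map (hmp s hs).measurable.aemeasurable
      hml.aestronglyMeasurable]
  have hvar : variance (fun ω => R p₀ p₁ ω t k V) (lawAt p₀ p₁ V τ) =
      (t + 1 - k : ℕ) * variance (logLR p₀ p₁ V) (postLaw p₀ p₁ V) := by
    have hind : iIndepFun (fun i (ω : GraphSeq N) => logLR p₀ p₁ V (ω i)) (lawAt p₀ p₁ V τ) :=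
      iIndepFun_infinitePi (P := lawSeq p₀ p₁ V τ) (X := fun _ => logLR p₀ p₁ V) fun _ => hml
    rw [hR, IndepFun.variance_sum hX2]
    · rw [Finset.sum_congr rfl (g := fun _ => variance (logLR p₀ p₁ V) (postLaw p₀ p₁ V)),
        Finset.sum_const, Nat.card_Icc, nsmul_eq_mul]
      intro s hs
      exact (hmp s hs).variance_fun_comp hml.aemeasurable
    · intro s hs s' hs' hne
      rw [Finset.mem_coe, Finset.mem_Icc] at hs hs'
      exact hind.indepFun (i := s - 1) (j := s' - 1) (by omega)
  have hR2 : MemLp (fun ω => R p₀ p₁ ω t k V) 2 (lawAt p₀ p₁ V τ) := by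
    rw [hR]; exact memLp_finsetSum' _ hX2
  have := meas_ge_le_variance_div_sq hR2 hc
  rwa [hmean, hvar] at this

/-! ### The information lower bound on the detection delay -/

/-- A stopping time of large mean has a block of length `w` in which it stops with small conditional
probability. -/
lemma exists_block_measure_lt {μ : Measure (GraphSeq N)} {S : GraphSeq N → ℕ∞}
    (hS : IsStoppingTime (history N) S) {w : ℕ} (hw : 0 < w) {ρ : ℝ≥0∞} (hρ : ρ ≤ 1)
    [IsProbabilityMeasure μ] (hE : w * ρ⁻¹ < ∫⁻ ω, (S ω : ℝ≥0∞) ∂μ) :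
    ∃ j : ℕ, (1 - ρ) * μ {ω | ((j * w : ℕ) : ℕ∞) < S ω} <
      μ {ω | (((j + 1) * w : ℕ) : ℕ∞) < S ω} := by
  by_contra! hcon
  set D : ℕ → Set (GraphSeq N) := fun j => {ω | ((j * w : ℕ) : ℕ∞) < S ω} with hD
  have hDm : ∀ j, MeasurableSet (D j) := fun j =>
    (history N).le _ _ (measurableSet_lt_stoppingTime hS _)
  have hpow : ∀ j, μ (D j) ≤ (1 - ρ) ^ j := by
    intro j
    induction j with
    | zero => simpa using prob_le_one
    | succ j ih =>
      refine (hcon j).trans ?_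
      rw [pow_succ, mul_comm]
      exact mul_le_mul_left ih _
  refine hE.not_ge ?_
  calc ∫⁻ ω, (S ω : ℝ≥0∞) ∂μ ≤ ∫⁻ ω, ∑' j, (D j).indicator (fun _ => (w : ℝ≥0∞)) ω ∂μ := by
        refine lintegral_mono fun ω => (natCast_le_tsum_blocks _ hw).trans ?_
        refine ENNReal.tsum_le_tsum fun j => ?_
        rw [Set.indicator_apply]
        exact le_of_eq rfl
    _ = ∑' j, w * μ (D j) := by
        rw [lintegral_tsum fun j => (measurable_const.indicator (hDm j)).aemeasurable]
        exact tsum_congr fun j => lintegral_indicator_const (hDm j) _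
    _ ≤ ∑' j, w * (1 - ρ) ^ j := ENNReal.tsum_le_tsum fun j => mul_le_mul_right (hpow j) _
    _ = w * ρ⁻¹ := by
        rw [ENNReal.tsum_mul_left, ENNReal.tsum_geometric,
          ENNReal.sub_sub_cancel ENNReal.one_ne_top hρ]

/-- Lower bound on the detection delay by a change of measure: in a block of length `w` where the
conditional probability of stopping is at most `ρ` under `ℙ_∞`, it is at most `q + exp c * ρ` when
the change occurs at the start of the block, where `q` bounds the probability that the
log-likelihood ratio of the block exceeds `c`. -/
lemma le_edd_of_lt_arl {p₀ p₁ : I} (hp₀ : 0 < p₀) (hp₀' : p₀ < 1) (hp₁ : 0 < p₁)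
    (hp₁' : p₁ < 1) (V : Finset (Fin N)) {S : GraphSeq N → ℕ∞}
    (hS : IsStoppingTime (history N) S) {w : ℕ} (hw : 0 < w) {ρ q : ℝ≥0∞} (hρ : ρ ≤ 1) (c : ℝ)
    (hE : w * ρ⁻¹ < arl p₀ S)
    (hq : ∀ t, lawAt p₀ p₁ V (t + 1) {ω | c < R p₀ p₁ ω (t + w) (t + 1) V} ≤ q) :
    w * (1 - (q + ENNReal.ofReal (Real.exp c) * ρ)) ≤ edd p₀ p₁ V S := by
  obtain ⟨j, hj⟩ := exists_block_measure_lt hS hw hρ hE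
  set t := j * w with ht
  have ht' : (j + 1) * w = t + w := by rw [ht]; ring
  rw [ht'] at hj
  set P := lawInfty N p₀
  set Q := lawAt p₀ p₁ V (t + 1)
  set A : Set (GraphSeq N) := {ω | (t : ℕ∞) < S ω}
  set A' : Set (GraphSeq N) := {ω | ((t + w : ℕ) : ℕ∞) < S ω}
  have hA : MeasurableSet[history N t] A := measurableSet_lt_stoppingTime hS t
  have hA' : MeasurableSet[history N (t + w)] A' := measurableSet_lt_stoppingTime hS _
  have hA2 : MeasurableSet[history N (t + w)] A := (history N).mono (Nat.le_add_right t w) _ hA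
  have hAm : MeasurableSet A := (history N).le _ _ hA
  have hAm' : MeasurableSet A' := (history N).le _ _ hA'
  have hsub : A' ⊆ A := by
    intro ω hω
    refine lt_of_le_of_lt ?_ (show ((t + w : ℕ) : ℕ∞) < S ω from hω)
    exact_mod_cast Nat.le_add_right t w
  have hPQ : Q A = P A := lawAt_eq_lawInfty hp₀ hp₀' hp₁ hp₁' V hA
  have hPA : P A ≠ 0 := by
    intro h0
    have : P A' = 0 := measure_mono_null hsub h0
    rw [this] at hj
    exact not_lt_zero hj
  -- under `ℙ_∞` the stopping time falls into the block with small probability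
  have hPD : P (A \ A') ≤ ρ * P A := by
    rw [measure_sdiff hsub hAm'.nullMeasurableSet (measure_ne_top _ _), tsub_le_iff_right]
    calc P A = (ρ + (1 - ρ)) * P A := by rw [add_tsub_cancel_of_le hρ, one_mul]
      _ = ρ * P A + (1 - ρ) * P A := add_mul _ _ _
      _ ≤ ρ * P A + P A' := by gcongr
  set Z : Set (GraphSeq N) := {ω | c < R p₀ p₁ ω (t + w) (t + 1) V}
  have hZ : MeasurableSet[history N (t + w)] Z :=
    measurableSet_lt_R p₀ p₁ (by omega) le_rfl V c
  have hZf : MeasurableSet[future N t] Z :=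
    measurable_R_future p₀ p₁ (by omega) _ V measurableSet_Ioi
  have hQD : Q (A \ A') ≤ (q + ENNReal.ofReal (Real.exp c) * ρ) * Q A := by
    have h1 : Q (A ∩ Z) ≤ q * Q A := by
      have := measure_inter_future (lawSeq p₀ p₁ V (t + 1)) hA hZf
      rw [← lawAt_eq] at this
      rw [this, mul_comm]
      exact mul_le_mul_left (hq t) _
    have h2 : Q ((A \ A') \ Z) ≤ ENNReal.ofReal (Real.exp c) * P ((A \ A') \ Z) := by
      refine measure_le_of_atom_le _ _ _ ((hA2.diff hA').diff hZ) fun ω hω => ?_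
      rw [lawAt_atom hp₀ hp₀' hp₁ hp₁' V (by omega)]
      gcongr
      exact not_lt.1 hω.2
    calc Q (A \ A') ≤ Q ((A ∩ Z) ∪ ((A \ A') \ Z)) := by
          refine measure_mono fun ω hω => ?_
          by_cases hz : ω ∈ Z
          · exact Or.inl ⟨hω.1, hz⟩
          · exact Or.inr ⟨hω, hz⟩
      _ ≤ Q (A ∩ Z) + Q ((A \ A') \ Z) := measure_union_le _ _
      _ ≤ q * Q A + ENNReal.ofReal (Real.exp c) * (ρ * P A) := by
          refine add_le_add h1 (h2.trans (mul_le_mul_right ?_ _))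
          exact (measure_mono Set.sdiff_subset).trans hPD
      _ = (q + ENNReal.ofReal (Real.exp c) * ρ) * Q A := by rw [hPQ]; ring
  have hQA' : (1 - (q + ENNReal.ofReal (Real.exp c) * ρ)) * Q A ≤ Q A' := by
    rw [ENNReal.sub_mul fun _ _ => measure_ne_top _ _, one_mul, tsub_le_iff_right]
    calc Q A = Q A' + Q (A \ A') := by
          rw [measure_sdiff hsub hAm'.nullMeasurableSet (measure_ne_top _ _),
            add_tsub_cancel_of_le (measure_mono hsub)]
      _ ≤ _ := by gcongr
  refine le_trans ?_ (le_iSup₂_of_le (f := fun (τ : ℕ) (_ : 1 ≤ τ) => essSup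
      (condLExp (history N (τ - 1)) (lawAt p₀ p₁ V τ) fun ω => ((S ω - (τ : ℕ∞) : ℕ∞) : ℝ≥0∞))
      (lawAt p₀ p₁ V τ)) (t + 1) (by omega) le_rfl)
  refine le_essSup_condLExp ((history N).le _) _ _ _ (A := A) hA (hPQ ▸ hPA) ?_
  calc w * (1 - (q + ENNReal.ofReal (Real.exp c) * ρ)) * Q A ≤ w * Q A' := by
        rw [mul_assoc]; exact mul_le_mul_right hQA' _
    _ = ∫⁻ ω in A, A'.indicator (fun _ => (w : ℝ≥0∞)) ω ∂Q := by
        rw [lintegral_indicator_const hAm', Measure.restrict_apply hAm',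
          Set.inter_eq_left.2 hsub]
    _ ≤ ∫⁻ ω in A, ((S ω - ((t + 1 : ℕ) : ℕ∞) : ℕ∞) : ℝ≥0∞) ∂Q := by
        refine lintegral_mono fun ω => ?_
        by_cases hω : ω ∈ A'
        swap
        · rw [Set.indicator_of_notMem hω]; exact zero_le
        rw [Set.indicator_of_mem hω]
        have h1 : ((t + w : ℕ) : ℕ∞) + 1 ≤ S ω := Order.add_one_le_of_lt hω
        have h2 : (w : ℕ∞) ≤ S ω - ((t + 1 : ℕ) : ℕ∞) := by
          refine ENat.le_sub_of_add_le_left (ENat.natCast_ne_top _) (le_trans (le_of_eq ?_) h1)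
          push_cast; ring
        simpa using ENat.toENNReal_le.2 h2

/-- The information lower bound to first order: a stopping time with average run length at least
`exp x` has detection delay at least `(1 - o(1)) x / J`. The block length is taken slightly below
`x / J`, so that the log-likelihood ratio of a block stays below `(1 - δ) x`. -/
lemma eventually_le_edd {p₀ p₁ : I} (hp₀ : 0 < p₀) (hp₀' : p₀ < 1) (hp₁ : 0 < p₁)
    (hp₁' : p₁ < 1) (V : Finset (Fin N)) (hJ : 0 < klInfo V.card p₀ p₁) {ε : ℝ} (hε : 0 < ε)
    (hε1 : ε < 1) :
    ∀ᶠ x : ℝ in atTop, ∀ S : GraphSeq N → ℕ∞, IsStoppingTime (history N) S →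
      ENNReal.ofReal (Real.exp x) ≤ arl p₀ S →
      ENNReal.ofReal ((1 - ε) * (x / klInfo V.card p₀ p₁)) ≤ edd p₀ p₁ V S := by
  set J := klInfo V.card p₀ p₁
  set σ2 := variance (logLR p₀ p₁ V) (postLaw p₀ p₁ V)
  have hσ2 : 0 ≤ σ2 := variance_nonneg _ _
  obtain ⟨δ, hδ, hδε⟩ : ∃ δ : ℝ, 0 < δ ∧ 2 * δ < ε := ⟨ε / 4, by positivity, by linarith⟩
  set a : ℝ := (1 - 2 * δ) / J with ha_def
  have ha : 0 < a := div_pos (by linarith) hJ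
  set w : ℝ → ℕ := fun x => ⌈a * x⌉₊ with hw_def
  have hw : Tendsto (fun x => (w x : ℝ) / x) atTop (𝓝 a) := tendsto_nat_ceil_mul_div_atTop ha.le
  have hgap : Tendsto (fun x => ((1 - δ) * x - w x * J) / x) atTop (𝓝 δ) := by
    have h : Tendsto (fun x => (1 - δ) - (w x : ℝ) / x * J) atTop (𝓝 ((1 - δ) - a * J)) :=
      tendsto_const_nhds.sub (hw.mul_const J)
    rw [show (1 - δ) - a * J = δ by rw [ha_def, div_mul_cancel₀ _ hJ.ne']; ring] at h
    refine h.congr' ?_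
    filter_upwards [eventually_gt_atTop 0] with x hx
    field_simp
  have hq : Tendsto (fun x => w x * σ2 / ((1 - δ) * x - w x * J) ^ 2) atTop (𝓝 0) := by
    have h := ((hw.mul_const σ2).div (hgap.pow 2) (by positivity)).mul tendsto_inv_atTop_zero
    rw [mul_zero] at h
    refine h.congr' ?_
    filter_upwards [eventually_gt_atTop 0] with x hx
    simp only [Pi.div_apply]
    field_simp
  have hρ : Tendsto (fun x => 2 * w x / Real.exp x) atTop (𝓝 0) := by
    have h := (hw.const_mul 2).mul (Real.tendsto_pow_mul_exp_neg_atTop_nhds_zero 1)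
    rw [mul_zero] at h
    refine h.congr' ?_
    filter_upwards [eventually_gt_atTop 0] with x hx
    rw [Real.exp_neg]
    field_simp
  have hcρ : Tendsto (fun x => Real.exp ((1 - δ) * x) * (2 * w x / Real.exp x)) atTop (𝓝 0) := by
    have h1 := (tendsto_rpow_mul_exp_neg_mul_atTop_nhds_zero 1 δ hδ)
    have h := (hw.const_mul 2).mul h1
    rw [mul_zero] at h
    refine h.congr' ?_
    filter_upwards [eventually_gt_atTop 0] with x hx
    rw [Real.rpow_one, show (1 - δ) * x = x + -δ * x by ring, Real.exp_add]
    have := (Real.exp_pos x).ne'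
    field_simp
  have hmain : Tendsto (fun x => (w x : ℝ) / x * (1 - (w x * σ2 / ((1 - δ) * x - w x * J) ^ 2 +
      Real.exp ((1 - δ) * x) * (2 * w x / Real.exp x)))) atTop (𝓝 a) := by
    simpa using hw.mul (tendsto_const_nhds (x := (1 : ℝ)).sub (hq.add hcρ))
  have haε : (1 - ε) / J < a := by
    rw [ha_def]; gcongr
  filter_upwards [eventually_gt_atTop 0, hgap.eventually (lt_mem_nhds hδ),
    hρ.eventually (gt_mem_nhds zero_lt_one), hmain.eventually (lt_mem_nhds haε)]
    with x hx hgapx hρx hmainx S hS hE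
  have hwpos : 0 < w x := Nat.ceil_pos.2 (mul_pos ha hx)
  have hw0 : (0 : ℝ) < w x := by exact_mod_cast hwpos
  have hgap0 : 0 < (1 - δ) * x - w x * J := by
    have := mul_pos hgapx hx
    rwa [div_mul_cancel₀ _ hx.ne'] at this
  have hexp := Real.exp_pos x
  have hρ0 : 0 < 2 * w x / Real.exp x := by positivity
  have key := le_edd_of_lt_arl hp₀ hp₀' hp₁ hp₁' V hS hwpos
    (ρ := ENNReal.ofReal (2 * w x / Real.exp x))
    (q := ENNReal.ofReal (w x * σ2 / ((1 - δ) * x - w x * J) ^ 2))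
    (ENNReal.ofReal_le_one.2 hρx.le) ((1 - δ) * x) ?_ ?_
  · refine le_trans ?_ key
    rw [← ENNReal.ofReal_mul (Real.exp_pos _).le, ← ENNReal.ofReal_add (by positivity)
      (by positivity), ← ENNReal.ofReal_one, ← ENNReal.ofReal_sub _ (by positivity),
      ← ENNReal.ofReal_natCast, ← ENNReal.ofReal_mul (by positivity)]
    refine ENNReal.ofReal_le_ofReal ?_
    have h := mul_le_mul_of_nonneg_right hmainx.le hx.le
    calc (1 - ε) * (x / J) = (1 - ε) / J * x := by ring
      _ ≤ _ := h
      _ = _ := by field_simp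
  · refine lt_of_lt_of_le ?_ hE
    rw [← ENNReal.ofReal_inv_of_pos hρ0, ← ENNReal.ofReal_natCast,
      ← ENNReal.ofReal_mul (by positivity)]
    refine (ENNReal.ofReal_lt_ofReal_iff hexp).2 ?_
    rw [show (w x : ℝ) * (2 * w x / Real.exp x)⁻¹ = Real.exp x / 2 by field_simp]
    linarith
  · intro t
    have h := lawAt_abs_R_sub_ge p₀ p₁ V (τ := t + 1) (k := t + 1) (by omega) le_rfl (t + w x) hgap0
    rw [show t + w x + 1 - (t + 1) = w x by omega] at h
    refine (measure_mono fun ω hω => ?_).trans h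
    simp only [Set.mem_ofPred_eq] at hω ⊢
    exact (sub_le_sub_right hω.le _).trans (le_abs_self _)

/-! ### The detection delay of the scan statistic -/

/-- The test applied to consecutive blocks of length `L` dominates the scan procedure: if the
log-likelihood ratio of a block is at most `b` with probability at most `q < 1`, then the delay
after `t₀` is at most `L / (1 - q)` on average. -/
lemma setLIntegral_scanTime_le (ν : ℕ → Measure (Graph N)) [∀ i, IsProbabilityMeasure (ν i)]
    (p₀ p₁ : I) {𝒱 : Finset (Finset (Fin N))} {V : Finset (Fin N)} (hV : V ∈ 𝒱) {m m' L : ℕ}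
    (hL : m' + 1 ≤ L) (hLm : L ≤ m + 1) (b : ℝ) (q : ℝ≥0∞) (t₀ : ℕ)
    (hq : ∀ k, t₀ < k → Measure.infinitePi ν {ω | R p₀ p₁ ω (k + L - 1) k V ≤ b} ≤ q)
    {A : Set (GraphSeq N)} (hA : MeasurableSet[history N t₀] A) :
    ∫⁻ ω in A, ((scanTime p₀ p₁ 𝒱 m m' b ω - (t₀ : ℕ∞) : ℕ∞) : ℝ≥0∞) ∂(Measure.infinitePi ν) ≤
      L * (1 - q)⁻¹ * Measure.infinitePi ν A := by
  refine setLIntegral_tsub_le_of_blocks ν (isStoppingTime_scanTime p₀ p₁ 𝒱 m m' b) t₀ L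
    (fun j => {ω | R p₀ p₁ ω (t₀ + j * L + 1 + L - 1) (t₀ + j * L + 1) V ≤ b}) q
    (fun j => measurable_R_future p₀ p₁ (by omega) _ V measurableSet_Iic)
    (fun j => hq _ (by omega)) (fun j ω hω => ?_) hA (by omega)
  by_contra hcon
  have hcon' : b < R p₀ p₁ ω (t₀ + j * L + 1 + L - 1) (t₀ + j * L + 1) V := not_le.1 hcon
  refine hω.not_ge ((scanTime_le_iff p₀ p₁ 𝒱 m m' b ω _).2 ?_)
  have h1 : (j + 1) * L = j * L + L := by ring
  exact ⟨t₀ + j * L + 1 + L - 1, Finset.mem_Icc.2 (by omega), t₀ + j * L + 1, by omega, V, hV,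
    hcon'⟩

lemma edd_scanTime_le (p₀ p₁ : I) {𝒱 : Finset (Finset (Fin N))} {V : Finset (Fin N)} (hV : V ∈ 𝒱)
    {m m' L : ℕ} (hL : m' + 1 ≤ L) (hLm : L ≤ m + 1) (b : ℝ)
    (hgap : 0 < L * klInfo V.card p₀ p₁ - b) :
    edd p₀ p₁ V (scanTime p₀ p₁ 𝒱 m m' b) ≤
      L * (1 - ENNReal.ofReal (L * variance (logLR p₀ p₁ V) (postLaw p₀ p₁ V) /
        (L * klInfo V.card p₀ p₁ - b) ^ 2))⁻¹ := by
  refine iSup₂_le fun τ hτ => essSup_condLExp_le ((history N).le _) _ _ _ fun A hA => ?_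
  refine le_trans (lintegral_mono fun ω => ?_)
    (setLIntegral_scanTime_le (lawSeq p₀ p₁ V τ) p₀ p₁ hV hL hLm b _ (τ - 1) (fun k hk => ?_) hA)
  · refine ENat.toENNReal_le.2 (tsub_le_tsub_left ?_ _)
    exact_mod_cast Nat.sub_le τ 1
  · have h := lawAt_abs_R_sub_ge p₀ p₁ V (τ := τ) (k := k) (by omega) (by omega) (k + L - 1) hgap
    rw [show k + L - 1 + 1 - k = L by omega] at h
    refine (measure_mono fun ω hω => ?_).trans h
    simp only [Set.mem_ofPred_eq] at hω ⊢
    rw [abs_sub_comm]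
    exact (sub_le_sub_left hω _).trans (le_abs_self _)

/-- The average run length is finite: some graph has log-likelihood ratio at least its mean under
the post-change law, and a whole block of copies of it occurs with positive probability. -/
lemma arl_scanTime_ne_top {p₀ : I} (hp₀ : 0 < p₀) (hp₀' : p₀ < 1) (p₁ : I)
    {𝒱 : Finset (Finset (Fin N))} {V : Finset (Fin N)} (hV : V ∈ 𝒱)
    {m m' L : ℕ} (hL : m' + 1 ≤ L) (hLm : L ≤ m + 1) (b : ℝ)
    (hgap : 0 < L * klInfo V.card p₀ p₁ - b) :
    arl p₀ (scanTime p₀ p₁ 𝒱 m m' b) ≠ ∞ := by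
  obtain ⟨G, hG⟩ := exists_integral_le (μ := postLaw p₀ p₁ V) (f := logLR p₀ p₁ V)
    Integrable.of_finite
  rw [integral_logLR] at hG
  set p := preLaw N p₀ {G}
  have hp : p ≠ 0 := (preLaw_singleton_pos hp₀ hp₀' G).ne'
  have h := setLIntegral_scanTime_le (fun _ => preLaw N p₀) p₀ p₁ hV hL hLm b (1 - p ^ L) 0
    (fun k hk => ?_) MeasurableSet.univ
  · rw [← lawInfty, measure_univ, mul_one, setLIntegral_univ] at h
    have harl : arl p₀ (scanTime p₀ p₁ 𝒱 m m' b) ≤ L * (1 - (1 - p ^ L))⁻¹ := by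
      simpa [arl] using h
    rw [ENNReal.sub_sub_cancel ENNReal.one_ne_top (pow_le_one' prob_le_one L)] at harl
    exact ne_top_of_le_ne_top
      (ENNReal.mul_ne_top (by simp) (ENNReal.inv_ne_top.2 (pow_ne_zero L hp))) harl
  · set E : Set (GraphSeq N) := Set.pi (Finset.Ico (k - 1) (k - 1 + L) : Set ℕ) fun _ => {G}
    have hE : Measure.infinitePi (fun _ : ℕ => preLaw N p₀) E = p ^ L := by
      rw [Measure.infinitePi_pi _ fun _ _ => MeasurableSet.singleton _, Finset.prod_const,
        Nat.card_Ico, Nat.add_sub_cancel_left]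
    have hEm : MeasurableSet E :=
      MeasurableSet.pi (Finset.countable_toSet _) fun _ _ => MeasurableSet.singleton _
    rw [← hE, ← prob_compl_eq_one_sub hEm]
    refine measure_mono fun ω hω hωE => ?_
    have hR : R p₀ p₁ ω (k + L - 1) k V = L * logLR p₀ p₁ V G := by
      rw [R, Finset.sum_congr rfl (g := fun _ => logLR p₀ p₁ V G), Finset.sum_const, Nat.card_Icc,
        nsmul_eq_mul, show k + L - 1 + 1 - k = L by omega]
      intro s hs
      rw [Finset.mem_Icc] at hs
      have : ω (s - 1) = G := hωE (s - 1) (by rw [Finset.mem_coe, Finset.mem_Ico]; omega)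
      rw [obs, this]
    have h1 : R p₀ p₁ ω (k + L - 1) k V ≤ b := hω
    rw [hR] at h1
    have h2 : (L : ℝ) * klInfo V.card p₀ p₁ ≤ L * logLR p₀ p₁ V G := by gcongr
    linarith

/-! ### First-order asymptotics -/

section Asymptotics

variable {p₀ p₁ : I} {𝒱 : Finset (Finset (Fin N))} {V : Finset (Fin N)} {l : Filter ℝ}
  {m m' : ℝ → ℕ} {b : ℝ → ℝ}

/-- Blocks of length just above `b / J` fit into the window and succeed with probability tending to
one, so the delay is asymptotically at most `b / J`. -/
lemma eventually_edd_scanTime_le (hp₀ : 0 < p₀) (hp₀' : p₀ < 1) (hV : V ∈ 𝒱)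
    (hJ : 0 < klInfo V.card p₀ p₁) (hb : Tendsto b l atTop)
    (hm' : Tendsto (fun α => (m' α : ℝ) / b α) l (𝓝 0))
    {x : ℝ} (hx : (klInfo V.card p₀ p₁)⁻¹ < x) (hm : ∀ᶠ α in l, x * b α ≤ m α)
    {ε : ℝ} (hε : 0 < ε) :
    ∀ᶠ α in l, arl p₀ (scanTime p₀ p₁ 𝒱 (m α) (m' α) (b α)) ≠ ∞ ∧
      edd p₀ p₁ V (scanTime p₀ p₁ 𝒱 (m α) (m' α) (b α)) ≤
        ENNReal.ofReal (((klInfo V.card p₀ p₁)⁻¹ + ε) * b α) := by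
  set J := klInfo V.card p₀ p₁ with hJdef
  set σ2 := variance (logLR p₀ p₁ V) (postLaw p₀ p₁ V) with hσ2def
  have hσ2 : 0 ≤ σ2 := variance_nonneg _ _
  obtain ⟨a, ha1, ha2⟩ := exists_between (lt_min hx (lt_add_of_pos_right J⁻¹ hε))
  obtain ⟨hax, haε⟩ := lt_min_iff.1 ha2
  have ha : 0 < a := (inv_pos.2 hJ).trans ha1
  have haJ : 0 < a * J - 1 := by
    have := mul_lt_mul_of_pos_right ha1 hJ
    rw [inv_mul_cancel₀ hJ.ne'] at this
    linarith
  set L : ℝ → ℕ := fun α => ⌈a * b α⌉₊ + (m' α + 1) with hLdef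
  have hL : Tendsto (fun α => (L α : ℝ) / b α) l (𝓝 a) := by
    have h1 := (tendsto_nat_ceil_mul_div_atTop ha.le).comp hb
    have h2 := (h1.add hm').add (tendsto_inv_atTop_zero.comp hb)
    simp only [add_zero] at h2
    refine h2.congr fun α => ?_
    simp only [Function.comp_apply, hLdef]
    push_cast
    ring
  have hgap : Tendsto (fun α => (L α * J - b α) / b α) l (𝓝 (a * J - 1)) := by
    refine ((hL.mul_const J).sub_const 1).congr' ?_
    filter_upwards [hb.eventually_gt_atTop 0] with α hα
    field_simp
  have hq : Tendsto (fun α => L α * σ2 / (L α * J - b α) ^ 2) l (𝓝 0) := by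
    have h := ((hL.mul_const σ2).div (hgap.pow 2) (by positivity)).mul
      (tendsto_inv_atTop_zero.comp hb)
    rw [mul_zero] at h
    refine h.congr' ?_
    filter_upwards [hb.eventually_gt_atTop 0] with α hα
    simp only [Pi.div_apply, Function.comp_apply]
    field_simp
  have hmain : Tendsto (fun α => (L α : ℝ) / b α * (1 - L α * σ2 / (L α * J - b α) ^ 2)⁻¹) l
      (𝓝 a) := by
    have h := hL.mul ((tendsto_const_nhds (x := (1 : ℝ)).sub hq).inv₀ (by norm_num))
    simpa using h
  filter_upwards [hb.eventually_gt_atTop 0, hm, hL.eventually (gt_mem_nhds hax),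
    hgap.eventually (lt_mem_nhds haJ), hq.eventually (gt_mem_nhds zero_lt_one),
    hmain.eventually (gt_mem_nhds haε)] with α hb0 hmα hLα hgapα hqα hmainα
  have hgap0 : 0 < L α * J - b α := by
    have := mul_pos hgapα hb0
    rwa [div_mul_cancel₀ _ hb0.ne'] at this
  have hLm' : m' α + 1 ≤ L α := Nat.le_add_left _ _
  have hLm : L α ≤ m α + 1 := by
    have h1 : (L α : ℝ) < x * b α := (div_lt_iff₀ hb0).1 hLα
    have h2 : (L α : ℝ) < m α := h1.trans_le hmα
    have h3 : L α < m α := by exact_mod_cast h2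
    omega
  refine ⟨arl_scanTime_ne_top hp₀ hp₀' p₁ hV hLm' hLm (b α) hgap0, ?_⟩
  refine (edd_scanTime_le p₀ p₁ hV hLm' hLm (b α) hgap0).trans ?_
  rw [← ENNReal.ofReal_one, ← ENNReal.ofReal_sub _ (by positivity),
    ← ENNReal.ofReal_inv_of_pos (sub_pos.2 hqα), ← ENNReal.ofReal_natCast,
    ← ENNReal.ofReal_mul (by positivity)]
  refine ENNReal.ofReal_le_ofReal ?_
  have h := mul_le_mul_of_nonneg_right hmainα.le hb0.le
  refine le_trans (le_of_eq ?_) h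
  field_simp

end Asymptotics

lemma tendsto_abs_log_nhdsGT_zero : Tendsto (fun α : ℝ => |Real.log α|) (𝓝[>] 0) atTop :=
  tendsto_abs_atBot_atTop.comp Real.tendsto_log_nhdsGT_zero

lemma eventually_mem_Ioo_nhdsGT_zero : ∀ᶠ α : ℝ in 𝓝[>] 0, α ∈ Set.Ioo (0 : ℝ) 1 :=
  Ioo_mem_nhdsGT zero_lt_one

/-- The threshold is `|log α|` up to the terms `log m` and `log (2 C)`. -/
lemma tendsto_threshold_div {m : ℝ → ℕ} {b : ℝ → ℝ} {C : ℝ} (hC : 0 < C)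
    (hm_log : (fun α : ℝ => Real.log (m α)) =o[𝓝[>] 0] Real.log)
    (hb : ∀ α ∈ Set.Ioo (0 : ℝ) 1, 2 * (m α : ℝ) * Real.exp (-b α) * C = α) :
    Tendsto (fun α => b α / |Real.log α|) (𝓝[>] 0) (𝓝 1) := by
  have h1 : Tendsto (fun α : ℝ => Real.log (2 * C) / |Real.log α|) (𝓝[>] 0) (𝓝 0) :=
    tendsto_const_nhds.div_atTop tendsto_abs_log_nhdsGT_zero
  have h2 : Tendsto (fun α : ℝ => Real.log (m α) / |Real.log α|) (𝓝[>] 0) (𝓝 0) :=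
    (isLittleO_abs_right.2 hm_log).tendsto_div_nhds_zero
  have h := (h1.add h2).add_const 1
  simp only [add_zero, zero_add] at h
  refine h.congr' ?_
  filter_upwards [eventually_mem_Ioo_nhdsGT_zero] with α hα
  have hlog : |Real.log α| = - Real.log α := abs_of_neg (Real.log_neg hα.1 hα.2)
  have hlogpos : 0 < |Real.log α| := abs_pos.2 (Real.log_neg hα.1 hα.2).ne
  have hm0 : (m α : ℝ) ≠ 0 := by
    intro h0
    have := hb α hα
    rw [h0] at this
    simp only [mul_zero, zero_mul] at this
    exact hα.1.ne this
  have hbα : Real.log α = Real.log (2 * C) + Real.log (m α) - b α := by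
    have hα' : α = 2 * C * m α * Real.exp (-b α) := by linear_combination -hb α hα
    conv_lhs => rw [hα']
    rw [Real.log_mul (by positivity) (Real.exp_ne_zero _), Real.log_mul (by positivity) hm0,
      Real.log_exp]
    ring
  rw [eq_div_iff hlogpos.ne', add_mul, add_mul, div_mul_cancel₀ _ hlogpos.ne',
    div_mul_cancel₀ _ hlogpos.ne', one_mul, hlog]
  linarith

/-- A family of stopping times is first-order optimal as soon as its delay is at most
`(J⁻¹ + o(1)) b`, where `b` is at most `(1 + o(1))` times the logarithm of its average run length:
the information lower bound gives the reverse inequality, for the family and for all its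
competitors. -/
lemma isFirstOrderOptimal_of_edd_le {p₀ p₁ : I} (hp₀ : 0 < p₀) (hp₀' : p₀ < 1) (hp₁ : 0 < p₁)
    (hp₁' : p₁ < 1) (V : Finset (Fin N)) (hJ : 0 < klInfo V.card p₀ p₁)
    {T : ℝ → GraphSeq N → ℕ∞} {r b ℓ : ℝ → ℝ}
    (hT : ∀ α ∈ Set.Ioo (0 : ℝ) 1, IsStoppingTime (history N) (T α))
    (harl : ∀ᶠ α in 𝓝[>] (0 : ℝ), arl p₀ (T α) ≠ ∞)
    (hr : Tendsto r (𝓝[>] 0) (𝓝 0))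
    (hedd : ∀ᶠ α in 𝓝[>] (0 : ℝ), edd p₀ p₁ V (T α) ≤
      ENNReal.ofReal (((klInfo V.card p₀ p₁)⁻¹ + r α) * b α))
    (hb : Tendsto b (𝓝[>] 0) atTop)
    (hℓ : Tendsto ℓ (𝓝[>] 0) atTop) (hbℓ : Tendsto (fun α => b α / ℓ α) (𝓝[>] 0) (𝓝 1))
    (hγ : ∀ᶠ α in 𝓝[>] (0 : ℝ), ENNReal.ofReal (Real.exp (ℓ α)) ≤ arl p₀ (T α)) :
    IsFirstOrderOptimal p₀ p₁ V (klInfo V.card p₀ p₁) T := by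
  set J := klInfo V.card p₀ p₁ with hJdef
  set γ : ℝ → ℝ := fun α => (arl p₀ (T α)).toReal with hγdef
  have hγℓ : ∀ᶠ α in 𝓝[>] (0 : ℝ), Real.exp (ℓ α) ≤ γ α := by
    filter_upwards [harl, hγ] with α h1 h2
    exact (ENNReal.ofReal_le_iff_le_toReal h1).1 h2
  have hγtop : Tendsto γ (𝓝[>] 0) atTop :=
    tendsto_atTop_mono' _ hγℓ (Real.tendsto_exp_atTop.comp hℓ)
  have hlogγ : Tendsto (fun α => Real.log (γ α)) (𝓝[>] 0) atTop :=
    Real.tendsto_log_atTop.comp hγtop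
  have hfin : ∀ᶠ α in 𝓝[>] (0 : ℝ), edd p₀ p₁ V (T α) ≠ ∞ :=
    hedd.mono fun α h => ne_top_of_le_ne_top ENNReal.ofReal_ne_top h
  have hmin : ∀ᶠ α in 𝓝[>] (0 : ℝ), minEdd p₀ p₁ V (arl p₀ (T α)) ≤ edd p₀ p₁ V (T α) :=
    eventually_mem_Ioo_nhdsGT_zero.mono fun α hα => iInf₂_le (T α) ⟨hT α hα, le_rfl⟩
  -- lower bound, for all competitors
  have hlow : ∀ ε : ℝ, 0 < ε → ε < 1 → ∀ᶠ α in 𝓝[>] (0 : ℝ),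
      ENNReal.ofReal ((1 - ε) * (Real.log (γ α) / J)) ≤ minEdd p₀ p₁ V (arl p₀ (T α)) := by
    intro ε hε hε1
    filter_upwards [hlogγ.eventually
      (eventually_le_edd hp₀ hp₀' hp₁ hp₁' V hJ hε hε1), harl, hγtop.eventually_gt_atTop 0]
      with α h1 h2 h3
    refine le_iInf₂ fun S hS => h1 S hS.1 ?_
    rw [Real.exp_log h3, hγdef, ENNReal.ofReal_toReal h2]
    exact hS.2
  have hup : Tendsto (fun α => (J⁻¹ + r α) * J * (b α / ℓ α)) (𝓝[>] 0) (𝓝 1) := by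
    have h := ((hr.const_add J⁻¹).mul_const J).mul hbℓ
    simpa [hJ.ne'] using h
  -- a quantity between the least delay and the delay of the family
  have hsandwich : ∀ D : ℝ → ℝ≥0∞,
      (∀ᶠ α in 𝓝[>] (0 : ℝ), minEdd p₀ p₁ V (arl p₀ (T α)) ≤ D α) →
      (∀ᶠ α in 𝓝[>] (0 : ℝ), D α ≤ edd p₀ p₁ V (T α)) →
      (fun α => (D α).toReal) ~[𝓝[>] 0] (fun α => Real.log (γ α) / J) := by
    intro D hD1 hD2
    refine (isEquivalent_iff_tendsto_one ?_).2 ?_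
    · filter_upwards [hlogγ.eventually_gt_atTop 0] with α h
      positivity
    refine tendsto_order.2 ⟨fun y hy => ?_, fun y hy => ?_⟩
    · obtain ⟨ε, hε, hε1⟩ := exists_between (lt_min (sub_pos.2 hy) one_pos)
      obtain ⟨hεy, hε1⟩ := lt_min_iff.1 hε1
      filter_upwards [hlow ε hε hε1, hD1, hD2, hfin, hlogγ.eventually_gt_atTop 0]
        with α h1 h2 h3 h4 h5
      have h6 := (ENNReal.ofReal_le_iff_le_toReal (ne_top_of_le_ne_top h4 h3)).1 (h1.trans h2)
      simp only [Pi.div_apply]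
      rw [lt_div_iff₀ (by positivity)]
      refine lt_of_lt_of_le ?_ h6
      exact mul_lt_mul_of_pos_right (by linarith) (by positivity)
    · filter_upwards [hup.eventually (gt_mem_nhds hy), hup.eventually (lt_mem_nhds one_half_lt_one),
        hD2, hedd, hγℓ, hℓ.eventually_gt_atTop 0, hb.eventually_gt_atTop 0]
        with α h1 h1' h2 h3 h4 h5 h6
      have h7 : ℓ α ≤ Real.log (γ α) := by
        rw [Real.le_log_iff_exp_le ((Real.exp_pos _).trans_le h4)]; exact h4
      have h8 : 0 < J⁻¹ + r α := by
        by_contra! hneg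
        have : (J⁻¹ + r α) * J * (b α / ℓ α) ≤ 0 :=
          mul_nonpos_of_nonpos_of_nonneg (mul_nonpos_of_nonpos_of_nonneg hneg hJ.le)
            (by positivity)
        linarith
      have h9 : (D α).toReal ≤ (J⁻¹ + r α) * b α :=
        ENNReal.toReal_le_of_le_ofReal (by positivity) (h2.trans h3)
      simp only [Pi.div_apply]
      refine lt_of_le_of_lt ?_ h1
      rw [div_le_iff₀ (by have := h5.trans_le h7; positivity)]
      calc (D α).toReal ≤ (J⁻¹ + r α) * b α := h9
        _ = (J⁻¹ + r α) * J * (b α / ℓ α) * (ℓ α / J) := by field_simp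
        _ ≤ (J⁻¹ + r α) * J * (b α / ℓ α) * (Real.log (γ α) / J) := by gcongr
  exact ⟨hT, harl.and hfin, hγtop, hsandwich _ hmin (Eventually.of_forall fun _ => le_rfl),
    hsandwich _ (Eventually.of_forall fun _ => le_rfl) hmin⟩

/-- Turns upper bounds with an arbitrarily small constant into a single bound with a null
function. -/
lemma exists_tendsto_zero_of_forall_eventually_le {l : Filter ℝ} {D : ℝ → ℝ≥0∞} {b : ℝ → ℝ}
    {y : ℝ} (hb : Tendsto b l atTop)
    (h : ∀ ε : ℝ, 0 < ε → ∀ᶠ α in l, D α ≤ ENNReal.ofReal ((y + ε) * b α)) (hy : 0 ≤ y) :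
    ∃ r : ℝ → ℝ, Tendsto r l (𝓝 0) ∧ ∀ᶠ α in l, D α ≤ ENNReal.ofReal ((y + r α) * b α) := by
  refine ⟨fun α => max 0 ((D α).toReal / b α - y), ?_, ?_⟩
  · refine tendsto_order.2 ⟨fun z hz => Eventually.of_forall fun α =>
      lt_of_lt_of_le hz (le_max_left _ _), fun z hz => ?_⟩
    filter_upwards [h (z / 2) (half_pos hz), hb.eventually_gt_atTop 0] with α h1 h2
    refine max_lt hz ?_
    have h3 := ENNReal.toReal_le_of_le_ofReal (by positivity) h1
    have h4 := (div_le_iff₀ h2).2 h3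
    linarith
  · filter_upwards [h 1 one_pos, hb.eventually_gt_atTop 0] with α h1 h2
    have h3 := le_max_left 0 ((D α).toReal / b α - y)
    refine (ENNReal.le_ofReal_iff_toReal_le (ne_top_of_le_ne_top ENNReal.ofReal_ne_top h1)
      (mul_nonneg (by linarith) h2.le)).2 ?_
    rw [← div_le_iff₀ h2]
    have := le_max_right 0 ((D α).toReal / b α - y)
    linarith

end GraphScan

end

theorem theorem2 (N n : ℕ) (hn : 2 ≤ n) (hnN : n < N)
    (p₀ p₁ : unitInterval) (hp₀ : 0 < p₀) (hp₀' : p₀ < 1) (hp₁ : 0 < p₁) (hp₁' : p₁ < 1)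
    (hne : p₁ ≠ p₀)
    (𝒱 : Finset (Finset (Fin N))) (h𝒱 : ∀ V ∈ 𝒱, V.card = n)
    (Vstar : Finset (Fin N)) (hVstar : Vstar ∈ 𝒱)
    (m m' : ℝ → ℕ) (b : ℝ → ℝ)
    (hm_liminf : (((klInfo n p₀ p₁)⁻¹ : ℝ) : EReal) <
      liminf (fun α : ℝ => (((m α : ℝ) / |Real.log α| : ℝ) : EReal)) (𝓝[>] 0))
    (hm_log : (fun α : ℝ => Real.log (m α)) =o[𝓝[>] 0] Real.log)
    (hm' : (fun α : ℝ => (m' α : ℝ)) =o[𝓝[>] 0] Real.log)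
    (hb : ∀ α ∈ Set.Ioo (0 : ℝ) 1, 2 * (m α : ℝ) * Real.exp (-b α) * (N.choose n : ℝ) = α) :
    (∀ α ∈ Set.Ioo (0 : ℝ) 1,
      ENNReal.ofReal ((1 / 2 - α) * ((m α : ℝ) / (2 * α) - 1)) ≤
        arl p₀ (scanTime p₀ p₁ 𝒱 (m α) (m' α) (b α))) ∧
    b ~[𝓝[>] 0] (fun α : ℝ => |Real.log α|) ∧
    Tendsto b (𝓝[>] 0) atTop ∧
    (∃ r : ℝ → ℝ, Tendsto r (𝓝[>] 0) (𝓝 0) ∧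
      ∀ᶠ α in 𝓝[>] (0 : ℝ),
        edd p₀ p₁ Vstar (scanTime p₀ p₁ 𝒱 (m α) (m' α) (b α)) ≤
          ENNReal.ofReal (((klInfo n p₀ p₁)⁻¹ + r α) * b α)) ∧
    IsFirstOrderOptimal p₀ p₁ Vstar (klInfo n p₀ p₁)
      (fun α => scanTime p₀ p₁ 𝒱 (m α) (m' α) (b α)) := by
  have hcard : Vstar.card = n := h𝒱 Vstar hVstar
  have hJ : 0 < klInfo n p₀ p₁ := klInfo_pos hn hp₀ hp₀' hp₁ hp₁' hne
  have hC : (0 : ℝ) < N.choose n := by exact_mod_cast Nat.choose_pos hnN.le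
  have h𝒱card : (𝒱.card : ℝ) ≤ N.choose n := by
    have h : 𝒱 ⊆ (Finset.univ : Finset (Fin N)).powersetCard n := fun V hV =>
      Finset.mem_powersetCard.2 ⟨Finset.subset_univ _, h𝒱 V hV⟩
    have := Finset.card_le_card h
    rw [Finset.card_powersetCard, Finset.card_univ, Fintype.card_fin] at this
    exact_mod_cast this
  have hm1 : ∀ α ∈ Set.Ioo (0 : ℝ) 1, 1 ≤ m α := by
    intro α hα
    by_contra! h0
    have h := hb α hα
    rw [Nat.lt_one_iff.1 h0] at h
    simp only [Nat.cast_zero, mul_zero, zero_mul] at h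
    exact hα.1.ne h
  have harl : ∀ α ∈ Set.Ioo (0 : ℝ) 1,
      ENNReal.ofReal ((1 / 2 - α) * ((m α : ℝ) / (2 * α) - 1)) ≤
        arl p₀ (scanTime p₀ p₁ 𝒱 (m α) (m' α) (b α)) := fun α hα =>
    le_arl_scanTime hp₀ hp₀' hp₁ hp₁' 𝒱 (hm1 α hα) (m' α) (b α) hα
      ((mul_le_mul_of_nonneg_left h𝒱card (by positivity)).trans (hb α hα).le)
  have hlog := tendsto_abs_log_nhdsGT_zero
  have hbdiv : Tendsto (fun α => b α / |Real.log α|) (𝓝[>] 0) (𝓝 1) :=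
    tendsto_threshold_div hC hm_log hb
  have hbequiv : b ~[𝓝[>] 0] (fun α : ℝ => |Real.log α|) :=
    (isEquivalent_iff_tendsto_one (hlog.eventually_ne_atTop 0)).2 hbdiv
  have hbtop : Tendsto b (𝓝[>] 0) atTop := hbequiv.symm.tendsto_atTop hlog
  have hm'b : Tendsto (fun α => (m' α : ℝ) / b α) (𝓝[>] 0) (𝓝 0) :=
    ((isLittleO_abs_right.2 hm').trans_isBigO hbequiv.symm.isBigO).tendsto_div_nhds_zero
  -- the window is eventually longer than `x b` for some `x > 1 / J`
  obtain ⟨y, hy1, hy2⟩ := EReal.exists_between_coe_real hm_liminf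
  have hy1' : (klInfo n p₀ p₁)⁻¹ < y := EReal.coe_lt_coe_iff.1 hy1
  obtain ⟨x, hx1, hx2⟩ := exists_between hy1'
  have hx0 : 0 < x := (inv_pos.2 hJ).trans hx1
  have hmx : ∀ᶠ α in 𝓝[>] (0 : ℝ), x * b α ≤ m α := by
    filter_upwards [eventually_lt_of_lt_liminf hy2,
      hbdiv.eventually (gt_mem_nhds ((one_lt_div hx0).2 hx2)), hlog.eventually_gt_atTop 0]
      with α h1 h2 h3
    have h1' : y * |Real.log α| < m α := (lt_div_iff₀ h3).1 (EReal.coe_lt_coe_iff.1 h1)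
    have h2' : b α < y / x * |Real.log α| := (div_lt_iff₀ h3).1 h2
    calc x * b α ≤ x * (y / x * |Real.log α|) := by gcongr
      _ = y * |Real.log α| := by field_simp
      _ ≤ m α := h1'.le
  subst hcard
  have hup := fun {ε : ℝ} (hε : 0 < ε) => eventually_edd_scanTime_le (m' := m') hp₀ hp₀' hVstar hJ
    hbtop hm'b hx1 hmx hε
  obtain ⟨r, hr, hedd⟩ := exists_tendsto_zero_of_forall_eventually_le hbtop
    (fun ε hε => (hup hε).mono fun α h => h.2) (inv_pos.2 hJ).le
  refine ⟨harl, hbequiv, hbtop, ⟨r, hr, hedd⟩, ?_⟩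
  -- for `α ≤ 1 / 4` the average run length is at least `1 / (16 α) = exp (|log α| - log 16)`
  refine isFirstOrderOptimal_of_edd_le hp₀ hp₀' hp₁ hp₁' Vstar hJ
    (ℓ := fun α => |Real.log α| - Real.log 16)
    (fun α _ => isStoppingTime_scanTime p₀ p₁ 𝒱 (m α) (m' α) (b α))
    ((hup one_pos).mono fun α h => h.1) hr hedd hbtop
    (tendsto_atTop_add_const_right _ _ hlog) ?_ ?_
  · have h1 : Tendsto (fun α : ℝ => 1 - Real.log 16 / |Real.log α|) (𝓝[>] 0) (𝓝 (1 - 0)) :=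
      tendsto_const_nhds.sub (tendsto_const_nhds.div_atTop hlog)
    have h2 := hbdiv.div h1 (by norm_num)
    simp only [sub_zero, div_one] at h2
    refine h2.congr' ?_
    filter_upwards [hlog.eventually_gt_atTop 0] with α h3
    simp only [Pi.div_apply]
    rw [div_div, mul_sub, mul_one, mul_div_cancel₀ _ h3.ne']
  · filter_upwards [eventually_mem_Ioo_nhdsGT_zero,
      Ioo_mem_nhdsGT (show (0 : ℝ) < 1 / 4 by norm_num)] with α hα hα4
    refine le_trans (ENNReal.ofReal_le_ofReal ?_) (harl α hα)
    have hα0 : 0 < α := hα.1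
    rw [abs_of_neg (Real.log_neg hα.1 hα.2), Real.exp_sub, Real.exp_neg, Real.exp_log hα0,
      Real.exp_log (by norm_num)]
    have hm1' : (1 : ℝ) ≤ m α := by exact_mod_cast hm1 α hα
    have h1 : 1 / (4 * α) ≤ (m α : ℝ) / (2 * α) - 1 := by
      have h2 : 1 / (2 * α) ≤ (m α : ℝ) / (2 * α) := by gcongr
      have h3 : 1 ≤ 1 / (4 * α) := by
        rw [one_le_div (by positivity)]; linarith [hα4.2]
      have h4 : 1 / (2 * α) = 1 / (4 * α) + 1 / (4 * α) := by field_simp; norm_num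
      linarith
    have h5 : (1 / 4 : ℝ) ≤ 1 / 2 - α := by linarith [hα4.2]
    calc α⁻¹ / 16 = 1 / 4 * (1 / (4 * α)) := by field_simp; norm_num
      _ ≤ (1 / 2 - α) * ((m α : ℝ) / (2 * α) - 1) := by gcongr
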